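/- **Setting.** There are $n$ parties; in an execution at most $f<n/3$ of them are corrupted (Byzantine) and may act arbitrarily; the others are honest. Honest parties run the partially synchronous BullShark protocol over reliable broadcast, as follows. *DAG.* A vertex carries a round, a source, a block, a set of strong edges (vertices of the previous round) and a set of weak edges (vertices of earlier rounds). Each honest party keeps a local DAG, whose round $0$ consists of $2f+1$ predefined vertices; $\mathrm{DAG}[r]$ is the set of its vertices of round $r$. A vertex delivered by reliable broadcast is legal if its source and round match the broadcast instance and it has at least $2f+1$ strong edges; a legal vertex is added to the DAG once all vertices it references are there. A (strong) path follows (strong) edges. When a party enters round $r$ it restarts its timer (of duration $\tau$), dequeues the next block of its queue, and adds to its DAG and reliably broadcasts a vertex of round $r$ with this block, with strong edges to all of $\mathrm{DAG}[r-1]$ and weak edges to all vertices of rounds $1,\dots,r-2$ of its DAG that it could not reach otherwise. Every honest party starts by entering round $1$. A party whose DAG has at least $2f+1$ vertices in a round above its current one enters that round. Waves $w=1,2,\dots$ consist of rounds $4w-3,\dots,4w$ and have predefined leaders $p_1(w)$ and $p_2(w)$, whose leader vertices are their vertices in rounds $4w-3$ and $4w-1$. Having at least $2f+1$ vertices in its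 current round $r$, a party enters round $r+1$ when its timer expires; after the handling of each delivered legal vertex it also does so if the timer has already expired or if, respectively for $r=4w-3,\,4w-2,\,4w-1,\,4w$: $\mathrm{DAG}[r]$ has a vertex of $p_1(w)$; $2f+1$ vertices of $\mathrm{DAG}[r]$ have a strong path to the first leader vertex of $w$; $\mathrm{DAG}[r]$ has a vertex of $p_2(w)$; $2f+1$ vertices of $\mathrm{DAG}[r]$ have a strong path to the second leader vertex of $w$. *Ordering.* When a vertex $v$ of round $4w-1$ (of round $4w+1$) is added to the DAG and at least $f+1$ of its strong edges lead to vertices with a strong path to the first (second) leader vertex of wave $w$, the party commits that leader vertex. It then walks back over the earlier leader rounds down to the round it committed last, also committing each leader vertex to which the leader committed just before has a strong path. Finally, from the earliest of these leaders to the latest, it outputs $a\_deliver(\text{block},\text{round},\text{source})$ for all not yet delivered vertices of rounds $\ge 1$ in the leader's causal history, in a deterministic order. A call $a\_bcast_k(b,q)$ puts $b$ into the queue of party $k$; the calls of an honest party have sequence numbers $q=1,2,3,\dots$. *Assumptions.* (a) Reliable broadcast satisfies Agreement, Integrity and Validity, and whatever is delivered from an honest party was broadcast by it before. (b) There is a time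 $GST$ such that whenever an honest party reliably broadcasts or delivers a vertex at a time $t\ge GST$, all honest parties deliver it by time $t+\Delta$, where $\Delta>0$. (c) The common timeout satisfies $\tau>3\Delta$. (d) Local computation takes no time, timers are exact, and only finitely many events happen in bounded time. (e) An honest party has a block in its queue whenever it creates a vertex. (f) For every $w_0$ there is a wave $w\ge w_0$ both of whose predefined leaders are honest. **Statement.** In every such execution Validity holds: if an honest party $k$ calls $a\_bcast_k(b,q)$, then every honest party eventually outputs $a\_deliver(b,q,k)$. Moreover, let $T\ge GST$ be a time by which everything that an honest party reliably broadcast or delivered before $GST$ has been delivered by all honest parties. If $w\ge 1$ is a wave both of whose predefined leaders are honest, and no honest party enters the first round of $w$ before time $T$, then every honest party eventually commits a leader vertex of wave $w$. -/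

import Mathlib

noncomputable section

namespace Bullshark

open scoped Classical

universe u v

/-! ### Vertices and the local DAG -/

/-- A vertex of the DAG: round, source, block, strong edges and weak edges.  The edges are
themselves vertices; they are stored as lists and read as finite sets. -/
inductive Vertex (P : Type u) (B : Type v) : Type (max u v) where
  | mk (round : ℕ) (source : P) (block : B) (strong weak : List (Vertex P B)) : Vertex P B

namespace Vertex

variable {P : Type u} {B : Type v}

def round : Vertex P B → ℕ
  | mk r _ _ _ _ => r

def source : Vertex P B → P
  | mk _ p _ _ _ => p

def block : Vertex P B → B
  | mk _ _ b _ _ => b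

def strongEdges : Vertex P B → Finset (Vertex P B)
  | mk _ _ _ s _ => s.toFinset

def weakEdges : Vertex P B → Finset (Vertex P B)
  | mk _ _ _ _ w => w.toFinset

def edges (x : Vertex P B) : Finset (Vertex P B) := x.strongEdges ∪ x.weakEdges

end Vertex

/-- The public parameters of the protocol.  There are more than `3 f` parties, at most `f` of
which are corrupted in an execution. -/
structure Setup (P : Type u) (B : Type v) [Fintype P] where
  f : ℕ
  card_parties : 3 * f < Fintype.card P
  /-- the duration of the round timer -/
  timeout : ℝ
  /-- the first predefined leader of a wave (waves are numbered from `1`) -/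
  leader₁ : ℕ → P
  /-- the second predefined leader of a wave -/
  leader₂ : ℕ → P
  /-- the hardcoded vertices of round `0` -/
  genesis : Finset (Vertex P B)
  genesis_card : genesis.card = 2 * f + 1
  genesis_round : ∀ x ∈ genesis, x.round = 0
  genesis_edges : ∀ x ∈ genesis, x.edges = ∅
  /-- the deterministic rule by which a finite set of vertices is listed for delivery -/
  order : Finset (Vertex P B) → List (Vertex P B)
  order_nodup : ∀ S, (order S).Nodup
  mem_order : ∀ S x, x ∈ order S ↔ x ∈ S

/-- The local state of a party. -/
structure State (P : Type u) (B : Type v) where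
  /-- whether the party has started the protocol -/
  started : Bool
  round : ℕ
  /-- `true` as long as the timer of the current round has not expired -/
  wait : Bool
  /-- the time at which the running timer was started; `none` if no timer is running -/
  timer : Option ℝ
  /-- all vertices of the local DAG; `DAG[r]` consists of those of round `r` -/
  dag : Finset (Vertex P B)
  buffer : Finset (Vertex P B)
  /-- `blocksToPropose` -/
  queue : List B
  /-- the last sequence number used in an `a_bcast` call -/
  seq : ℕ
  /-- records that a vertex had to be created while `queue` was empty -/
  starved : Bool
  /-- the vertices `x` for which `r_bcast (x, x.round)` has been called -/
  sent : Finset (Vertex P B)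
  committedRound : ℕ
  /-- the leader vertices committed so far, directly or indirectly -/
  committed : Finset (Vertex P B)
  /-- `deliveredVertices` -/
  delivered : Finset (Vertex P B)
  /-- the `a_deliver (block, sequence number, source)` outputs so far -/
  output : List (B × ℕ × P)

section Protocol

variable {P : Type u} {B : Type v}

/-- `DAG[r]`. -/
def layer (dag : Finset (Vertex P B)) (r : ℕ) : Finset (Vertex P B) :=
  dag.filter fun x => x.round = r

/-- A path from `x` to `y` along strong and weak edges, inside the DAG after its start `x`. -/
def Path (dag : Finset (Vertex P B)) (x y : Vertex P B) : Prop :=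
  Relation.ReflTransGen (fun a b => b ∈ dag ∧ 1 ≤ b.round ∧ b ∈ a.edges) x y

/-- A path from `x` to `y` along strong edges only. -/
def StrongPath (dag : Finset (Vertex P B)) (x y : Vertex P B) : Prop :=
  Relation.ReflTransGen (fun a b => b ∈ dag ∧ 1 ≤ b.round ∧ b ∈ a.strongEdges) x y

/-- The vertex of party `p` in round `r` of the DAG, if there is one. -/
def getVertex (dag : Finset (Vertex P B)) (p : P) (r : ℕ) : Option (Vertex P B) :=
  if h : ∃ x, x ∈ layer dag r ∧ x.source = p then some h.choose else none

/-- Weak edges of a new vertex: go through the rounds `r, r - 1, …, 1`, each time adding the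
vertices of the round that cannot yet be reached from `strong` and the weak edges `weak`
collected so far. -/
def setWeakEdges (dag strong : Finset (Vertex P B)) :
    ℕ → Finset (Vertex P B) → Finset (Vertex P B)
  | 0, weak => weak
  | r + 1, weak =>
      setWeakEdges dag strong r
        (weak ∪ (layer dag (r + 1)).filter fun y => ¬ ∃ e ∈ strong ∪ weak, Path dag e y)

/-- `create_new_vertex (r)` by party `i`, with block `b`. -/
def createVertex (i : P) (r : ℕ) (b : B) (dag : Finset (Vertex P B)) : Vertex P B :=
  Vertex.mk r i b (layer dag (r - 1)).toList
    (setWeakEdges dag (layer dag (r - 1)) (r - 2) ∅).toList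

/-- The wave `⌈r / 4⌉` of round `r`. -/
def wave (r : ℕ) : ℕ := (r + 3) / 4

variable [Fintype P] (c : Setup P B)

/-- The vertex of the first predefined leader of wave `w`. -/
def firstLeader (dag : Finset (Vertex P B)) (w : ℕ) : Option (Vertex P B) :=
  if w = 0 then none else getVertex dag (c.leader₁ w) (4 * w - 3)

/-- The vertex of the second predefined leader of wave `w`. -/
def secondLeader (dag : Finset (Vertex P B)) (w : ℕ) : Option (Vertex P B) :=
  if w = 0 then none else getVertex dag (c.leader₂ w) (4 * w - 1)

/-! ### Committing and ordering -/

/-- One iteration of `order_vertices`: output the part of the causal history of the leader `x`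
that has not been delivered yet. -/
def orderLeader (s : State P B) (x : Vertex P B) : State P B :=
  let todo := s.dag.filter fun y => 1 ≤ y.round ∧ Path s.dag x y ∧ y ∉ s.delivered
  { s with
    output := s.output ++ (c.order todo).map fun y => (y.block, y.round, y.source)
    delivered := s.delivered ∪ todo }

/-- The loop of `commit_leader`: go through the rounds `r, r - 2, …` above `bound` and push the
leader of each round to which the leader `x` pushed last has a strong path. -/
def collectLeaders (dag : Finset (Vertex P B)) (bound r : ℕ) (x : Vertex P B)
    (stack : List (Vertex P B)) : List (Vertex P B) :=
  if _h : bound < r then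
    match (if r % 4 = 1 then firstLeader c dag (wave r) else secondLeader c dag (wave r)) with
    | some y =>
        if StrongPath dag x y then collectLeaders dag bound (r - 2) y (y :: stack)
        else collectLeaders dag bound (r - 2) x stack
    | none => collectLeaders dag bound (r - 2) x stack
  else stack
termination_by r
decreasing_by all_goals omega

/-- `commit_leader (x)`. -/
def commitLeader (s : State P B) (x : Vertex P B) : State P B :=
  let stack := collectLeaders c s.dag s.committedRound (x.round - 2) x [x]
  stack.foldl (orderLeader c)
    { s with committedRound := x.round, committed := s.committed ∪ stack.toFinset }

/-- `try_commit (votes, leader)`. -/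
def tryCommit (s : State P B) (votes : Finset (Vertex P B)) :
    Option (Vertex P B) → State P B
  | none => s
  | some x =>
      if c.f + 1 ≤ (votes.filter fun y => StrongPath s.dag y x).card then commitLeader c s x
      else s

/-- `try_ordering (x)` of the partially synchronous protocol. -/
def tryOrdering (s : State P B) (x : Vertex P B) : State P B :=
  if x.round % 4 = 1 then
    tryCommit c s x.strongEdges (secondLeader c s.dag (wave x.round - 1))
  else if x.round % 4 = 3 then
    tryCommit c s x.strongEdges (firstLeader c s.dag (wave x.round))
  else s

/-! ### Constructing the DAG -/

/-- Party `i` enters round `r` at time `now`: it starts the timer and calls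
`broadcast_vertex (r)`. -/
def beginRound (i : P) (now : ℝ) (r : ℕ) (s : State P B) : State P B :=
  match s.queue with
  | [] => { s with round := r, timer := some now, wait := true, starved := true }
  | b :: q =>
      let x := createVertex i r b s.dag
      tryOrdering c
        { s with
          round := r
          timer := some now
          wait := true
          queue := q
          dag := insert x s.dag
          buffer := s.buffer.erase x
          sent := insert x s.sent } x

/-- All references of `x` are in the DAG. -/
def Ready (s : State P B) (x : Vertex P B) : Prop := x.edges ⊆ s.dag

/-- The successful branch of `try_add_to_dag (x)`. -/
def addVertex (i : P) (now : ℝ) (s : State P B) (x : Vertex P B) : State P B :=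
  let s₁ : State P B := { s with dag := insert x s.dag, buffer := s.buffer.erase x }
  let s₂ : State P B :=
    if 2 * c.f + 1 ≤ (layer s₁.dag x.round).card ∧ s₁.round < x.round then
      beginRound c i now x.round s₁
    else s₁
  tryOrdering c s₂ x

/-- One buffered vertex whose references are all in the DAG is moved to the DAG. -/
def AddStep (i : P) (now : ℝ) (s s' : State P B) : Prop :=
  ∃ x ∈ s.buffer, Ready s x ∧ s' = addVertex c i now s x

/-- Buffered vertices are moved to the DAG, in any order, until none is ready. -/
def Flush (i : P) (now : ℝ) (s s' : State P B) : Prop :=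
  Relation.ReflTransGen (AddStep c i now) s s' ∧ ∀ x ∈ s'.buffer, ¬ Ready s' x

/-- `try_advance_round ()`. -/
def tryAdvance (i : P) (now : ℝ) (s : State P B) : State P B :=
  if 2 * c.f + 1 ≤ (layer s.dag s.round).card then beginRound c i now (s.round + 1) s else s

/-- `2f + 1` vertices of the current round have a strong path to the given leader vertex. -/
def HasVotes (s : State P B) (leader : Option (Vertex P B)) : Prop :=
  ∃ x, leader = some x ∧
    ∃ U ⊆ layer s.dag s.round, U.card = 2 * c.f + 1 ∧ ∀ y ∈ U, StrongPath s.dag y x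

/-- The condition under which a party tries to advance from its current round. -/
def MayAdvance (s : State P B) : Prop :=
  s.wait = false ∨
  (s.round % 4 = 1 ∧ ∃ x ∈ layer s.dag s.round, x.source = c.leader₁ (wave s.round)) ∨
  (s.round % 4 = 2 ∧ HasVotes c s (firstLeader c s.dag (wave s.round))) ∨
  (s.round % 4 = 3 ∧ ∃ x ∈ layer s.dag s.round, x.source = c.leader₂ (wave s.round)) ∨
  (s.round % 4 = 0 ∧ HasVotes c s (secondLeader c s.dag (wave s.round)))

/-- `x`, delivered by reliable broadcast in instance `(r, p)`, is a legal vertex. -/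
def Legal (x : Vertex P B) (r : ℕ) (p : P) : Prop :=
  x.source = p ∧ x.round = r ∧ 2 * c.f + 1 ≤ x.strongEdges.card ∧
    (∀ y ∈ x.strongEdges, y.round + 1 = x.round) ∧ (∀ y ∈ x.weakEdges, y.round + 1 < x.round)

/-- The handler of `r_deliver_i (x, r, p)`. -/
def Deliver (i : P) (now : ℝ) (x : Vertex P B) (r : ℕ) (p : P) (s s' : State P B) : Prop :=
  (¬ Legal c x r p ∧ s' = s) ∨
  (Legal c x r p ∧ ∃ s₁, Flush c i now { s with buffer := insert x s.buffer } s₁ ∧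
    s' = if MayAdvance c s₁ then tryAdvance c i now s₁ else s₁)

/-- The state of a party before it starts. -/
def initialState : State P B where
  started := false
  round := 1
  wait := true
  timer := none
  dag := c.genesis
  buffer := ∅
  queue := []
  seq := 0
  starved := false
  sent := ∅
  committedRound := 0
  committed := ∅
  delivered := ∅
  output := []

end Protocol

/-! ### Executions -/

/-- The events at a party `i`. -/
inductive Event (P : Type u) (B : Type v) : Type (max u v) where
  /-- `a_bcast_i (b, k)` is called -/
  | aBcast (i : P) (b : B) (k : ℕ) : Event P B
  /-- `i` starts the protocol -/
  | start (i : P) : Event P B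
  /-- `r_deliver_i (x, r, p)` is output by the reliable broadcast -/
  | deliver (i : P) (x : Vertex P B) (r : ℕ) (p : P) : Event P B
  /-- the timer of `i` expires -/
  | timeout (i : P) : Event P B

/-- The party at which an event occurs. -/
def Event.party {P : Type u} {B : Type v} : Event P B → P
  | aBcast i _ _ => i
  | start i => i
  | deliver i _ _ _ => i
  | timeout i => i

/-- The effect at time `now` of an event on the state of the honest party at which it occurs.
The sequence numbers of the `a_bcast` calls of a party are `1, 2, 3, …`. -/
def Step {P : Type u} {B : Type v} [Fintype P] (c : Setup P B) (now : ℝ)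
    (s s' : State P B) : Event P B → Prop
  | .aBcast _ b k => k = s.seq + 1 ∧ s' = { s with queue := s.queue ++ [b], seq := k }
  | .start i => s.started = false ∧ s' = beginRound c i now 1 { s with started := true }
  | .deliver i x r p => s.started = true ∧ Deliver c i now x r p s s'
  | .timeout i =>
      ∃ t₀, s.timer = some t₀ ∧ now = t₀ + c.timeout ∧
        s' = tryAdvance c i now { s with timer := none, wait := false }

/-- An execution: an infinite sequence of timed events, finitely many in bounded time.  Honest
parties, those that are never corrupted, follow the protocol; the states and events of corrupted
parties are unconstrained. -/
structure Execution {P : Type u} {B : Type v} [Fintype P] (c : Setup P B) where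
  corrupted : Finset P
  card_corrupted : corrupted.card ≤ c.f
  /-- the `n`-th event -/
  event : ℕ → Event P B
  /-- the time of the `n`-th event -/
  time : ℕ → ℝ
  /-- the states of the parties just before the `n`-th event -/
  state : ℕ → P → State P B
  time_mono : Monotone time
  time_unbounded : Filter.Tendsto time Filter.atTop Filter.atTop
  state_zero : ∀ i, i ∉ corrupted → state 0 i = initialState c
  state_step : ∀ n i, i ∉ corrupted → (event n).party = i →
    Step c (time n) (state n i) (state (n + 1) i) (event n)
  state_idle : ∀ n i, i ∉ corrupted → (event n).party ≠ i → state (n + 1) i = state n i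
  /-- every honest party starts -/
  starts : ∀ i, i ∉ corrupted → ∃ n, event n = Event.start i
  /-- a running timer expires on time -/
  timer_expires : ∀ n i t₀, i ∉ corrupted → (state n i).timer = some t₀ →
    time n ≤ t₀ + c.timeout

namespace Execution

variable {P : Type u} {B : Type v} [Fintype P] {c : Setup P B} (e : Execution c)

def Honest (i : P) : Prop := i ∉ e.corrupted

/-- Party `i` calls `r_bcast_i (x, x.round)` during the `n`-th event. -/
def RBcast (n : ℕ) (i : P) (x : Vertex P B) : Prop :=
  x ∉ (e.state n i).sent ∧ x ∈ (e.state (n + 1) i).sent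

/-- The guarantees of reliable broadcast: a delivered message of an honest party was broadcast
by that party before, Agreement, Integrity and Validity. -/
structure ReliableBroadcast : Prop where
  authenticity : ∀ n i x r p, e.Honest i → e.Honest p → e.event n = .deliver i x r p →
    x.round = r ∧ x ∈ (e.state n p).sent
  agreement : ∀ n i j x r p, e.Honest i → e.Honest j → e.event n = .deliver i x r p →
    ∃ m, e.event m = .deliver j x r p
  integrity : ∀ m n i x y r p, e.Honest i → e.event m = .deliver i x r p →
    e.event n = .deliver i y r p → m = n
  validity : ∀ n i j x, e.Honest i → e.Honest j → e.RBcast n i x →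
    ∃ m, e.event m = .deliver j x x.round i

/-- Whatever an honest party reliably broadcasts or delivers at a time `t ≥ GST` is delivered by
all honest parties by time `t + Δ`. -/
structure TimelyBroadcast (Δ GST : ℝ) : Prop where
  of_deliver : ∀ n i j x r p, e.Honest i → e.Honest j → GST ≤ e.time n →
    e.event n = .deliver i x r p → ∃ m, e.event m = .deliver j x r p ∧ e.time m ≤ e.time n + Δ
  of_bcast : ∀ n i j x, e.Honest i → e.Honest j → GST ≤ e.time n → e.RBcast n i x →
    ∃ m, e.event m = .deliver j x x.round i ∧ e.time m ≤ e.time n + Δ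

/-- Whatever an honest party reliably broadcast or delivered before `GST` is delivered by all
honest parties by time `T`. -/
structure CaughtUp (GST T : ℝ) : Prop where
  of_deliver : ∀ n i j x r p, e.Honest i → e.Honest j → e.time n < GST →
    e.event n = .deliver i x r p → ∃ m, e.event m = .deliver j x r p ∧ e.time m ≤ T
  of_bcast : ∀ n i j x, e.Honest i → e.Honest j → e.time n < GST → e.RBcast n i x →
    ∃ m, e.event m = .deliver j x x.round i ∧ e.time m ≤ T

/-- Honest parties have a message to propose whenever they create a vertex. -/
def NeverStarved : Prop := ∀ n i, e.Honest i → (e.state n i).starved = false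

/-- Every honest party enters round `r`, that is, broadcasts its vertex of round `r`, at time
`T` or later, if it does. -/
def EntersAfter (r : ℕ) (T : ℝ) : Prop :=
  ∀ n i x, e.Honest i → e.RBcast n i x → x.round = r → T ≤ e.time n

/-- Party `i` eventually commits a leader of wave `w`. -/
def CommitsInWave (i : P) (w : ℕ) : Prop :=
  ∃ n, ∃ x ∈ (e.state n i).committed,
    (x.round = 4 * w - 3 ∧ x.source = c.leader₁ w) ∨ (x.round = 4 * w - 1 ∧ x.source = c.leader₂ w)

/-- Validity of Byzantine Atomic Broadcast: if an honest party `k` calls `a_bcast_k (b, q)`, then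
every honest party `i` eventually outputs `a_deliver_i (b, q, k)`. -/
def Validity : Prop :=
  ∀ n k b q, e.Honest k → e.event n = .aBcast k b q →
    ∀ i, e.Honest i → ∃ m, (b, q, k) ∈ (e.state m i).output

end Execution

end Bullshark

end

namespace Bullshark

open scoped Classical

universe u v

section

variable {P : Type u} {B : Type v}

/-! ### Layers and paths -/

/-! Commitment is a race between timers and message delays. Let `a` be the first entry of an honest
party into the second round of the wave. Within `Δ` the quorum behind this entry brings all honest
parties into the first round. Within another `Δ` they all hold a quorum of that round and the vertex
of the honest first leader, hence leave it. Their timers bring them into the third round by time `a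
+ 2Δ + τ`.

Let `b` be the first honest entry into the third round. It is not a jump, because a quorum in a
round contains a vertex broadcast earlier by an honest party. If it rests on `2f + 1` votes for the
first leader, the new vertex has these votes among its strong edges, and everybody who adds it
commits that leader. Otherwise a timer of the second round has expired, so `b ≥ a + τ`, and the
second leader enters the third round by `b + 2Δ`. Its vertex is everywhere by `b + 3Δ < b + τ`,
before any honest timer of the third round expires. So every honest vertex of the fourth round has a
strong edge to it: a party advances after its timer, or upon seeing the leader vertex, or jumps
after an honest vertex which has that edge already. A quorum of the fourth round contains `f + 1`
honest vertices, and every honest vertex of the next round triggers the commit. This is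
`Synchronous.exists_commit`.

For Validity, rounds are never skipped and each consumes one block, so the `q`-th block of an honest
party sits in its vertex of round `q`. That vertex reaches all honest DAGs. An honest leader vertex
created later has a path to it, because weak edges cover whatever strong edges miss. A late wave
with honest leaders commits such a leader vertex and thereby delivers the block. A suitable `T`
exists since only finitely many events precede `GST`.

One event may add several vertices, enter rounds and commit. It is therefore split into elementary
steps (`Micro`), and `Inv`, `Delivered` and `Queued` are shown to survive each of them. -/

theorem mem_layer {d : Finset (Vertex P B)} {r : ℕ} {x : Vertex P B} :
    x ∈ layer d r ↔ x ∈ d ∧ x.round = r := by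
  simp [layer]

theorem layer_mono {d d' : Finset (Vertex P B)} (h : d ⊆ d') (r : ℕ) : layer d r ⊆ layer d' r :=
  Finset.filter_subset_filter _ h

theorem layer_insert_of_ne {d : Finset (Vertex P B)} {r : ℕ} {x : Vertex P B} (h : x.round ≠ r) :
    layer (insert x d) r = layer d r := by
  simp [layer, Finset.filter_insert, h]

/-- A set of vertices that contains all references of its members. -/
def Closed (d : Finset (Vertex P B)) : Prop := ∀ x ∈ d, x.edges ⊆ d

theorem strongEdges_subset_edges (x : Vertex P B) : x.strongEdges ⊆ x.edges :=
  Finset.subset_union_left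

theorem Closed.insert {d : Finset (Vertex P B)} (h : Closed d) {x : Vertex P B}
    (hx : x.edges ⊆ d) : Closed (insert x d) := by
  intro y hy
  rcases Finset.mem_insert.1 hy with rfl | hy
  · exact hx.trans (Finset.subset_insert _ _)
  · exact (h y hy).trans (Finset.subset_insert _ _)

theorem StrongPath.mono {d d' : Finset (Vertex P B)} (h : d ⊆ d') {x y : Vertex P B}
    (hp : StrongPath d x y) : StrongPath d' x y :=
  Relation.ReflTransGen.mono (fun _ _ hab => ⟨h hab.1, hab.2⟩) _ _ hp

theorem Path.mono {d d' : Finset (Vertex P B)} (h : d ⊆ d') {x y : Vertex P B}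
    (hp : Path d x y) : Path d' x y :=
  Relation.ReflTransGen.mono (fun _ _ hab => ⟨h hab.1, hab.2⟩) _ _ hp

/-- A closed set contains everything reachable from its members. Hence, with `Path.restrict`, the
causal history of a vertex does not change as a DAG grows and is the same at all parties that hold
the vertex. -/
theorem StrongPath.restrict {d d' : Finset (Vertex P B)} (hd : Closed d) {x y : Vertex P B}
    (hx : x ∈ d) (hp : StrongPath d' x y) : y ∈ d ∧ StrongPath d x y := by
  induction hp with
  | refl => exact ⟨hx, .refl⟩
  | tail _ hab ih =>
    have := hd _ ih.1 (strongEdges_subset_edges _ hab.2.2)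
    exact ⟨this, ih.2.tail ⟨this, hab.2⟩⟩

theorem Path.restrict {d d' : Finset (Vertex P B)} (hd : Closed d) {x y : Vertex P B}
    (hx : x ∈ d) (hp : Path d' x y) : y ∈ d ∧ Path d x y := by
  induction hp with
  | refl => exact ⟨hx, .refl⟩
  | tail _ hab ih =>
    have := hd _ ih.1 hab.2.2
    exact ⟨this, ih.2.tail ⟨this, hab.2⟩⟩

/-! ### New vertices -/

/-- A vertex of the round under inspection is either reachable already, and stays so because the
collected set only grows, or it is collected itself and reached by the empty path. -/
theorem setWeakEdges_spec (d strong : Finset (Vertex P B)) (r : ℕ) :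
    ∀ weak : Finset (Vertex P B), weak ⊆ setWeakEdges d strong r weak ∧
      (∀ y ∈ setWeakEdges d strong r weak, y ∈ weak ∨ y ∈ d ∧ 1 ≤ y.round ∧ y.round ≤ r) ∧
      ∀ y ∈ d, 1 ≤ y.round → y.round ≤ r →
        ∃ e ∈ strong ∪ setWeakEdges d strong r weak, Path d e y := by
  induction r with
  | zero => intro weak; simp only [setWeakEdges]; exact ⟨subset_rfl, fun y hy => .inl hy, by omega⟩
  | succ r ih =>
    intro weak
    simp only [setWeakEdges]
    obtain ⟨h1, h2, h3⟩ := ih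
      (weak ∪ (layer d (r + 1)).filter fun y => ¬ ∃ e ∈ strong ∪ weak, Path d e y)
    refine ⟨Finset.subset_union_left.trans h1, fun y hy => ?_, fun y hy hy1 hyr => ?_⟩
    · rcases h2 y hy with h | h
      · rcases Finset.mem_union.1 h with h | h
        · exact .inl h
        · have := mem_layer.1 (Finset.mem_filter.1 h).1
          exact .inr ⟨this.1, by omega, by omega⟩
      · exact .inr ⟨h.1, h.2.1, by omega⟩
    · rcases Nat.lt_or_ge y.round (r + 1) with h | h
      · exact h3 y hy hy1 (by omega)
      · by_cases hp : ∃ e ∈ strong ∪ weak, Path d e y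
        · obtain ⟨e, he, hp⟩ := hp
          refine ⟨e, Finset.union_subset_union subset_rfl (Finset.subset_union_left.trans h1) he, hp⟩
        · refine ⟨y, Finset.mem_union_right _ (h1 (Finset.mem_union_right _ ?_)), .refl⟩
          exact Finset.mem_filter.2 ⟨mem_layer.2 ⟨hy, by omega⟩, hp⟩

section createVertex

variable (i : P) (r : ℕ) (b : B) (d : Finset (Vertex P B))

@[simp] theorem createVertex_round : (createVertex i r b d).round = r := rfl

@[simp] theorem createVertex_source : (createVertex i r b d).source = i := rfl

@[simp] theorem createVertex_block : (createVertex i r b d).block = b := rfl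

theorem createVertex_strongEdges : (createVertex i r b d).strongEdges = layer d (r - 1) := by
  simp [createVertex, Vertex.strongEdges]

theorem createVertex_weakEdges : (createVertex i r b d).weakEdges =
    setWeakEdges d (layer d (r - 1)) (r - 2) ∅ := by
  simp [createVertex, Vertex.weakEdges]

theorem createVertex_edges_subset : (createVertex i r b d).edges ⊆ d := by
  intro y hy
  rw [Vertex.edges, createVertex_strongEdges, createVertex_weakEdges] at hy
  rcases Finset.mem_union.1 hy with h | h
  · exact (mem_layer.1 h).1
  · rcases (setWeakEdges_spec d _ _ ∅).2.1 y h with h | h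
    · simp at h
    · exact h.1

theorem createVertex_weakEdges_round {y : Vertex P B}
    (hy : y ∈ (createVertex i r b d).weakEdges) : 1 ≤ y.round ∧ y.round + 1 < r := by
  rw [createVertex_weakEdges] at hy
  rcases (setWeakEdges_spec d _ _ ∅).2.1 y hy with h | h
  · simp at h
  · omega

/-- The source of Validity: round `r - 1` is covered by the strong edges, and the rounds from `1` to
`r - 2` by the weak ones. -/
theorem path_createVertex {y : Vertex P B} (hy : y ∈ d) (hy1 : 1 ≤ y.round) (hyr : y.round < r) :
    Path d (createVertex i r b d) y := by
  rcases Nat.lt_or_ge (y.round + 1) r with h | h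
  · obtain ⟨e, he, hp⟩ := (setWeakEdges_spec d (layer d (r - 1)) (r - 2) ∅).2.2 y hy hy1 (by omega)
    rw [← createVertex_weakEdges i r b, ← createVertex_strongEdges i r b] at he
    have hed := createVertex_edges_subset i r b d he
    refine Relation.ReflTransGen.head ⟨hed, ?_, he⟩ hp
    rcases Finset.mem_union.1 he with h' | h'
    · rw [createVertex_strongEdges] at h'
      have := (mem_layer.1 h').2
      omega
    · exact (createVertex_weakEdges_round i r b d h').1
  · refine Relation.ReflTransGen.single ⟨hy, hy1, strongEdges_subset_edges _ ?_⟩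
    rw [createVertex_strongEdges]
    exact mem_layer.2 ⟨hy, by omega⟩

end createVertex

/-! ### Ordering -/

/-- `s'` results from `s` by committing and ordering: only the corresponding components change. -/
structure SameCore (s s' : State P B) : Prop where
  started : s'.started = s.started
  round : s'.round = s.round
  wait : s'.wait = s.wait
  timer : s'.timer = s.timer
  dag : s'.dag = s.dag
  buffer : s'.buffer = s.buffer
  queue : s'.queue = s.queue
  seq : s'.seq = s.seq
  starved : s'.starved = s.starved
  sent : s'.sent = s.sent

theorem SameCore.refl (s : State P B) : SameCore s s := by constructor <;> rfl

theorem SameCore.trans {s s' s'' : State P B} (h : SameCore s s') (h' : SameCore s' s'') :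
    SameCore s s'' := by
  constructor
  · rw [h'.started, h.started]
  · rw [h'.round, h.round]
  · rw [h'.wait, h.wait]
  · rw [h'.timer, h.timer]
  · rw [h'.dag, h.dag]
  · rw [h'.buffer, h.buffer]
  · rw [h'.queue, h.queue]
  · rw [h'.seq, h.seq]
  · rw [h'.starved, h.starved]
  · rw [h'.sent, h.sent]

/-- The causal history of every committed vertex is delivered, and what is delivered is output. -/
structure Delivered (s : State P B) : Prop where
  committed_mem : ∀ x ∈ s.committed, x ∈ s.dag
  delivered_of_path : ∀ x ∈ s.committed, ∀ y ∈ s.dag, 1 ≤ y.round → Path s.dag x y →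
    y ∈ s.delivered
  output_of_delivered : ∀ y ∈ s.delivered, (y.block, y.round, y.source) ∈ s.output

/-- Since the old DAG is closed, new vertices add nothing to the causal history of a vertex
committed before. -/
theorem Delivered.mono {s s' : State P B} (h : Delivered s) (hc : Closed s.dag)
    (hd : s.dag ⊆ s'.dag) (h1 : s'.committed = s.committed) (h2 : s'.delivered = s.delivered)
    (h3 : s'.output = s.output) : Delivered s' := by
  refine ⟨fun x hx => ?_, fun x hx y _ hy1 hp => ?_, by rw [h2, h3]; exact h.3⟩
  · exact hd (h.1 x (h1 ▸ hx))
  · rw [h1] at hx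
    rw [h2]
    obtain ⟨hy, hp⟩ := hp.restrict hc (h.1 x hx)
    exact h.2 x hx y hy hy1 hp

theorem getVertex_eq_some {d : Finset (Vertex P B)} {p : P} {r : ℕ} {x : Vertex P B}
    (h : getVertex d p r = some x) : x ∈ d ∧ x.round = r ∧ x.source = p := by
  unfold getVertex at h
  split_ifs at h with hx
  cases h
  have := hx.choose_spec
  exact ⟨(mem_layer.1 this.1).1, (mem_layer.1 this.1).2, this.2⟩

/-- `getVertex` chooses arbitrarily; uniqueness pins the choice down. -/
theorem getVertex_of_unique {d : Finset (Vertex P B)} {x : Vertex P B} (hx : x ∈ d)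
    (hu : ∀ y ∈ d, y.round = x.round → y.source = x.source → y = x) :
    getVertex d x.source x.round = some x := by
  have h : ∃ y, y ∈ layer d x.round ∧ y.source = x.source := ⟨x, mem_layer.2 ⟨hx, rfl⟩, rfl⟩
  have hs := h.choose_spec
  rw [getVertex, dif_pos h]
  exact congrArg some (hu _ (mem_layer.1 hs.1).1 (mem_layer.1 hs.1).2 hs.2)

variable [Fintype P] (c : Setup P B)

theorem firstLeader_mem {d : Finset (Vertex P B)} {w : ℕ} {x : Vertex P B}
    (h : firstLeader c d w = some x) :
    1 ≤ w ∧ x ∈ d ∧ x.round = 4 * w - 3 ∧ x.source = c.leader₁ w := by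
  unfold firstLeader at h
  split_ifs at h with hw
  exact ⟨by omega, getVertex_eq_some h⟩

theorem secondLeader_mem {d : Finset (Vertex P B)} {w : ℕ} {x : Vertex P B}
    (h : secondLeader c d w = some x) :
    1 ≤ w ∧ x ∈ d ∧ x.round = 4 * w - 1 ∧ x.source = c.leader₂ w := by
  unfold secondLeader at h
  split_ifs at h with hw
  exact ⟨by omega, getVertex_eq_some h⟩

theorem collectLeaders_spec (d : Finset (Vertex P B)) (bound r : ℕ) (x : Vertex P B)
    (stack : List (Vertex P B)) (hs : ∀ y ∈ stack, y ∈ d) :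
    (∀ y ∈ collectLeaders c d bound r x stack, y ∈ d) ∧
      stack ⊆ collectLeaders c d bound r x stack := by
  induction r using Nat.strong_induction_on generalizing x stack with
  | _ r ih =>
    unfold collectLeaders
    by_cases hb : bound < r
    · rw [dif_pos hb]
      split
      · rename_i y hy
        have hyd : y ∈ d := by
          split_ifs at hy
          · exact (firstLeader_mem c hy).2.1
          · exact (secondLeader_mem c hy).2.1
        split_ifs
        · have := ih (r - 2) (by omega) y (y :: stack) (by
            intro z hz
            rcases List.mem_cons.1 hz with rfl | hz
            · exact hyd
            · exact hs z hz)
          exact ⟨this.1, fun z hz => this.2 (List.mem_cons_of_mem _ hz)⟩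
        · exact ih (r - 2) (by omega) x stack hs
      · exact ih (r - 2) (by omega) x stack hs
    · rw [dif_neg hb]
      exact ⟨hs, fun _ h => h⟩

theorem foldl_orderLeader_spec (l : List (Vertex P B)) : ∀ s : State P B,
    SameCore s (l.foldl (orderLeader c) s) ∧
    (l.foldl (orderLeader c) s).committed = s.committed ∧
    s.delivered ⊆ (l.foldl (orderLeader c) s).delivered ∧
    (∀ x ∈ l, ∀ y ∈ s.dag, 1 ≤ y.round → Path s.dag x y →
      y ∈ (l.foldl (orderLeader c) s).delivered) ∧
    ((∀ y ∈ s.delivered, (y.block, y.round, y.source) ∈ s.output) →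
      ∀ y ∈ (l.foldl (orderLeader c) s).delivered,
        (y.block, y.round, y.source) ∈ (l.foldl (orderLeader c) s).output) := by
  induction l with
  | nil => intro s; exact ⟨.refl s, rfl, subset_rfl, by simp, fun h => h⟩
  | cons a l ih =>
    intro s
    obtain ⟨h1, h2, h3, h4, h5⟩ := ih (orderLeader c s a)
    have h0 : SameCore s (orderLeader c s a) := by constructor <;> rfl
    simp only [List.foldl_cons]
    refine ⟨h0.trans h1, h2, Finset.subset_union_left.trans h3, ?_, fun h => h5 ?_⟩
    · intro x hx y hy hy1 hp
      rcases List.mem_cons.1 hx with rfl | hx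
      · apply h3
        by_cases hyd : y ∈ s.delivered
        · exact Finset.mem_union_left _ hyd
        · exact Finset.mem_union_right _ (Finset.mem_filter.2 ⟨hy, hy1, hp, hyd⟩)
      · exact h4 x hx y hy hy1 hp
    · intro y hy
      rcases Finset.mem_union.1 hy with hy | hy
      · exact List.mem_append_left _ (h y hy)
      · exact List.mem_append_right _ (List.mem_map.2 ⟨y, (c.mem_order _ _).2 hy, rfl⟩)

theorem commitLeader_spec (s : State P B) (x : Vertex P B) (hx : x ∈ s.dag) :
    SameCore s (commitLeader c s x) ∧ s.committed ⊆ (commitLeader c s x).committed ∧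
      x ∈ (commitLeader c s x).committed ∧ (Delivered s → Delivered (commitLeader c s x)) := by
  have hst := collectLeaders_spec c s.dag s.committedRound (x.round - 2) x [x]
    (by simpa using hx)
  unfold commitLeader
  set stack := collectLeaders c s.dag s.committedRound (x.round - 2) x [x]
  set s₀ : State P B :=
    { s with committedRound := x.round, committed := s.committed ∪ stack.toFinset }
  obtain ⟨h1, h2, h3, h4, h5⟩ := foldl_orderLeader_spec c stack s₀
  have h0 : SameCore s s₀ := by constructor <;> rfl
  refine ⟨h0.trans h1, ?_, ?_, fun hd => ⟨?_, ?_, h5 hd.output_of_delivered⟩⟩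
  · rw [h2]; exact Finset.subset_union_left
  · rw [h2]; exact Finset.mem_union_right _ (List.mem_toFinset.2 (hst.2 (by simp)))
  · rw [h2, h1.dag]
    intro y hy
    rcases Finset.mem_union.1 hy with hy | hy
    · exact hd.committed_mem y hy
    · exact hst.1 y (List.mem_toFinset.1 hy)
  · rw [h2, h1.dag]
    intro z hz y hy hy1 hp
    rcases Finset.mem_union.1 hz with hz | hz
    · exact h3 (hd.delivered_of_path z hz y hy hy1 hp)
    · exact h4 z (List.mem_toFinset.1 hz) y hy hy1 hp

theorem tryOrdering_cases (s : State P B) (x : Vertex P B) :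
    tryOrdering c s x = s ∨ ∃ y ∈ s.dag, tryOrdering c s x = commitLeader c s y := by
  have key : ∀ (votes : Finset (Vertex P B)) (l : Option (Vertex P B)),
      (∀ y, l = some y → y ∈ s.dag) →
      tryCommit c s votes l = s ∨ ∃ y ∈ s.dag, tryCommit c s votes l = commitLeader c s y := by
    intro votes l hl
    cases l with
    | none => exact .inl rfl
    | some y =>
      simp only [tryCommit]
      split_ifs
      · exact .inr ⟨y, hl y rfl, rfl⟩
      · exact .inl rfl
  unfold tryOrdering
  split_ifs
  · exact key _ _ fun y hy => (secondLeader_mem c hy).2.1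
  · exact key _ _ fun y hy => (firstLeader_mem c hy).2.1
  · exact .inl rfl

theorem tryOrdering_sameCore (s : State P B) (x : Vertex P B) :
    SameCore s (tryOrdering c s x) := by
  rcases tryOrdering_cases c s x with h | ⟨y, hy, h⟩ <;> rw [h]
  · exact .refl s
  · exact (commitLeader_spec c s y hy).1

theorem tryOrdering_committed (s : State P B) (x : Vertex P B) :
    s.committed ⊆ (tryOrdering c s x).committed := by
  rcases tryOrdering_cases c s x with h | ⟨y, hy, h⟩ <;> rw [h]
  exact (commitLeader_spec c s y hy).2.1

theorem tryOrdering_delivered {s : State P B} (hs : Delivered s) (x : Vertex P B) :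
    Delivered (tryOrdering c s x) := by
  rcases tryOrdering_cases c s x with h | ⟨y, hy, h⟩ <;> rw [h]
  · exact hs
  · exact (commitLeader_spec c s y hy).2.2.2 hs

/-- Committing the leader vertex `l` of wave `w` is decided by its votes among the strong edges
of `x`. -/
def Decides (x l : Vertex P B) (w : ℕ) : Prop :=
  1 ≤ w ∧ ((x.round = 4 * w - 1 ∧ l.round = 4 * w - 3 ∧ l.source = c.leader₁ w) ∨
    (x.round = 4 * w + 1 ∧ l.round = 4 * w - 1 ∧ l.source = c.leader₂ w))

theorem mem_committed_tryOrdering {s : State P B} {x l : Vertex P B} {w : ℕ}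
    (h : Decides c x l w) (hl : l ∈ s.dag)
    (hu : ∀ y ∈ s.dag, y.round = l.round → y.source = l.source → y = l)
    (hv : c.f + 1 ≤ (x.strongEdges.filter fun y => StrongPath s.dag y l).card) :
    l ∈ (tryOrdering c s x).committed := by
  obtain ⟨hw, ⟨hx, hr, hp⟩ | ⟨hx, hr, hp⟩⟩ := h
  · have hfl : firstLeader c s.dag (wave x.round) = some l := by
      have : wave x.round = w := by unfold wave; omega
      rw [this, firstLeader, if_neg (by omega), ← hr, ← hp]
      exact getVertex_of_unique hl hu
    rw [tryOrdering, if_neg (by omega), if_pos (by omega), hfl, tryCommit, if_pos hv]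
    exact (commitLeader_spec c s l hl).2.2.1
  · have hfl : secondLeader c s.dag (wave x.round - 1) = some l := by
      -- Round `4 * w + 1` already belongs to wave `w + 1`.
      have : wave x.round - 1 = w := by unfold wave; omega
      rw [this, secondLeader, if_neg (by omega), ← hr, ← hp]
      exact getVertex_of_unique hl hu
    rw [tryOrdering, if_pos (by omega), hfl, tryCommit, if_pos hv]
    exact (commitLeader_spec c s l hl).2.2.1

end

section

variable {P : Type u} {B : Type v}

/-! ### Decomposition of events into elementary steps -/

/-- Party `i` enters round `r` with the vertex made of block `b`, leaving `q` in the queue. -/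
noncomputable def openRound (i : P) (now : ℝ) (r : ℕ) (b : B) (q : List B)
    (s : State P B) : State P B :=
  { s with
    round := r
    timer := some now
    wait := true
    queue := q
    dag := insert (createVertex i r b s.dag) s.dag
    buffer := s.buffer.erase (createVertex i r b s.dag)
    sent := insert (createVertex i r b s.dag) s.sent }

variable [Fintype P] (c : Setup P B)

/-- Elementary steps of party `i` during the event `ev` at time `now`.  Next to the state they act
on the finite set of those vertices of the DAG for which `tryOrdering` is still to be called. -/
inductive Micro (i : P) (now : ℝ) (ev : Event P B) :
    State P B × Finset (Vertex P B) → State P B × Finset (Vertex P B) → Prop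
  | enqueue (s p b k) (hev : ev = .aBcast i b k) (hk : k = s.seq + 1) :
      Micro i now ev (s, p) ({ s with queue := s.queue ++ [b], seq := k }, p)
  | expire (s p t₀) (ht : s.timer = some t₀) (hnow : now = t₀ + c.timeout) :
      Micro i now ev (s, p) ({ s with timer := none, wait := false }, p)
  | receive (s p x r q) (hev : ev = .deliver i x r q) (hx : Legal c x r q)
      (hs : s.started = true) :
      Micro i now ev (s, p) ({ s with buffer := insert x s.buffer }, p)
  | add (s x) (hx : x ∈ s.buffer) (hr : Ready s x) :
      Micro i now ev (s, ∅) ({ s with dag := insert x s.dag, buffer := s.buffer.erase x }, {x})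
  | start (s p b q) (hq : s.queue = b :: q) (hs : s.started = false) :
      Micro i now ev (s, p) (openRound i now 1 b q { s with started := true },
        insert (createVertex i 1 b s.dag) p)
  | jump (s p r b q) (hq : s.queue = b :: q) (hr : s.round < r)
      (hl : 2 * c.f + 1 ≤ (layer s.dag r).card) :
      Micro i now ev (s, p) (openRound i now r b q s, insert (createVertex i r b s.dag) p)
  | advance (s p b q) (hq : s.queue = b :: q) (hm : MayAdvance c s)
      (hl : 2 * c.f + 1 ≤ (layer s.dag s.round).card) (hs : s.started = true) :
      Micro i now ev (s, p) (openRound i now (s.round + 1) b q s,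
        insert (createVertex i (s.round + 1) b s.dag) p)
  -- The side condition says that no jump to the round of `x` is due: `addVertex` tests for a jump
  -- before it orders `x`. It allows `Inv.quorum` to survive the removal of `x` from the pending
  -- set.
  | order (s p x) (hx : x ∈ s.dag)
      (hr : ¬ (2 * c.f + 1 ≤ (layer s.dag x.round).card ∧ s.round < x.round)) :
      Micro i now ev (s, p) (tryOrdering c s x, p.erase x)

/-- Sequences of elementary steps. -/
abbrev Micros (i : P) (now : ℝ) (ev : Event P B) :
    State P B × Finset (Vertex P B) → State P B × Finset (Vertex P B) → Prop :=
  Relation.ReflTransGen (Micro c i now ev)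

variable {c} {i : P} {now : ℝ} {ev : Event P B}

theorem beginRound_nil {r : ℕ} {s : State P B} (h : s.queue = []) :
    (beginRound c i now r s).starved = true := by
  unfold beginRound; rw [h]

theorem beginRound_cons {r : ℕ} {s : State P B} {b : B} {q : List B} (h : s.queue = b :: q) :
    beginRound c i now r s =
      tryOrdering c (openRound i now r b q s) (createVertex i r b s.dag) := by
  unfold beginRound; rw [h]; rfl

/-- The flag is never reset. If it is false after an event, no round was begun with an empty queue
at any point inside the event. -/
theorem starved_beginRound {r : ℕ} {s : State P B} (h : s.starved = true) :
    (beginRound c i now r s).starved = true := by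
  rcases hq : s.queue with _ | ⟨b, q⟩
  · exact beginRound_nil hq
  · rw [beginRound_cons hq, (tryOrdering_sameCore c _ _).starved]; exact h

theorem started_beginRound {r : ℕ} {s : State P B} :
    (beginRound c i now r s).started = s.started := by
  rcases hq : s.queue with _ | ⟨b, q⟩
  · unfold beginRound; rw [hq]
  · rw [beginRound_cons hq, (tryOrdering_sameCore c _ _).started]; rfl

theorem exists_queue_of_not_starved {r : ℕ} {s : State P B}
    (h : (beginRound c i now r s).starved = false) : ∃ b q, s.queue = b :: q := by
  rcases hq : s.queue with _ | ⟨b, q⟩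
  · rw [beginRound_nil hq] at h; cases h
  · exact ⟨b, q, rfl⟩

/-- Two states appear because of `start`, where the vertex is written in terms of the state before
`started` is set; the DAGs agree. -/
theorem micro_order_open {r : ℕ} {s s₀ : State P B} {b : B} {q : List B}
    {p : Finset (Vertex P B)} (hs : s.dag = s₀.dag) (hp : createVertex i r b s₀.dag ∉ p) :
    Micro c i now ev (openRound i now r b q s, insert (createVertex i r b s₀.dag) p)
      (tryOrdering c (openRound i now r b q s) (createVertex i r b s₀.dag), p) := by
  have := Micro.order (c := c) (i := i) (now := now) (ev := ev) (openRound i now r b q s)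
    (insert (createVertex i r b s₀.dag) p) (createVertex i r b s₀.dag)
    (by simp [openRound, hs]) (by simp [openRound])
  rwa [Finset.erase_insert hp] at this

/-- In the case of a jump two vertices become pending. The party's own new vertex is ordered first,
and then `x`, which had completed the quorum. -/
theorem micros_addVertex {s : State P B} {x : Vertex P B}
    (hx : x ∈ s.buffer) (hr : Ready s x) (hst : (addVertex c i now s x).starved = false) :
    Micros c i now ev (s, ∅) (addVertex c i now s x, ∅) := by
  refine .head (.add s x hx hr) ?_
  unfold addVertex at hst ⊢
  set s₁ : State P B := { s with dag := insert x s.dag, buffer := s.buffer.erase x }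
  dsimp only at hst ⊢
  rw [(tryOrdering_sameCore c _ _).starved] at hst
  split_ifs at hst ⊢ with hj
  · obtain ⟨b, q, hq⟩ := exists_queue_of_not_starved hst
    refine .head (.jump s₁ _ x.round b q hq hj.2 hj.1) ?_
    rw [beginRound_cons hq]
    set y := createVertex i x.round b s₁.dag
    have h1 : Micro c i now ev (openRound i now x.round b q s₁, insert y {x})
        (tryOrdering c (openRound i now x.round b q s₁) y, (insert y {x} : Finset _).erase y) :=
      .order _ _ _ (by simp [openRound, y]) (by simp [openRound, y])
    refine .head h1 ?_
    have hcore := tryOrdering_sameCore c (openRound i now x.round b q s₁) y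
    have h2 := Micro.order (c := c) (i := i) (now := now) (ev := ev)
      (tryOrdering c (openRound i now x.round b q s₁) y) ((insert y {x} : Finset _).erase y) x
      (by rw [hcore.dag]; simp [openRound, s₁]) (by rw [hcore.round]; simp [openRound])
    have h3 : (((insert y {x} : Finset (Vertex P B)).erase y).erase x) = ∅ := by
      ext z; simp; tauto
    rw [h3] at h2
    exact .single h2
  · have h2 := Micro.order (c := c) (i := i) (now := now) (ev := ev) s₁ {x} x
      (by simp [s₁]) hj
    rw [Finset.erase_singleton] at h2
    exact .single h2

theorem starved_addVertex {s : State P B} {x : Vertex P B} (h : s.starved = true) :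
    (addVertex c i now s x).starved = true := by
  unfold addVertex
  dsimp only
  rw [(tryOrdering_sameCore c _ _).starved]
  split_ifs
  · exact starved_beginRound h
  · exact h

theorem started_addVertex {s : State P B} {x : Vertex P B} :
    (addVertex c i now s x).started = s.started := by
  unfold addVertex
  dsimp only
  rw [(tryOrdering_sameCore c _ _).started]
  split_ifs
  · exact started_beginRound
  · rfl

theorem micros_flush {s s' : State P B}
    (h : Relation.ReflTransGen (AddStep c i now) s s') (hst : s'.starved = false) :
    Micros c i now ev (s, ∅) (s', ∅) ∧ s'.started = s.started := by
  induction h with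
  | refl => exact ⟨.refl, rfl⟩
  | tail _ hab ih =>
    rename_i u _ _
    obtain ⟨x, hx, hr, rfl⟩ := hab
    have hu : u.starved = false := by
      by_contra h
      rw [starved_addVertex (by simpa using h)] at hst
      cases hst
    exact ⟨(ih hu).1.trans (micros_addVertex hx hr hst), started_addVertex.trans (ih hu).2⟩

theorem micros_tryAdvance {s : State P B} (hs : s.started = true) (hm : MayAdvance c s)
    (hst : (tryAdvance c i now s).starved = false) :
    Micros c i now ev (s, ∅) (tryAdvance c i now s, ∅) := by
  unfold tryAdvance at hst ⊢
  split_ifs at hst ⊢ with hl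
  · obtain ⟨b, q, hq⟩ := exists_queue_of_not_starved hst
    refine .head (.advance s _ b q hq hm hl hs) ?_
    rw [beginRound_cons hq]
    exact .single (micro_order_open rfl (by simp))
  · exact .refl

theorem starved_tryAdvance {s : State P B} (h : s.starved = true) :
    (tryAdvance c i now s).starved = true := by
  unfold tryAdvance
  split_ifs
  · exact starved_beginRound h
  · exact h

/-- Every event is a sequence of elementary steps. -/
theorem micros_of_step {s s' : State P B} (h : Step c now s s' ev) (hp : ev.party = i)
    (hst : s'.starved = false) (htimer : s.timer ≠ none → s.started = true) :
    Micros c i now ev (s, ∅) (s', ∅) := by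
  cases ev with
  | aBcast j b k =>
    obtain ⟨hk, rfl⟩ := h
    cases hp
    exact .single (.enqueue s _ b k rfl hk)
  | start j =>
    obtain ⟨h0, rfl⟩ := h
    cases hp
    obtain ⟨b, q, hq⟩ := exists_queue_of_not_starved hst
    refine .head (.start s _ b q hq h0) ?_
    rw [beginRound_cons hq]
    exact .single (micro_order_open rfl (by simp))
  | deliver j x r p =>
    obtain ⟨hs, ⟨-, rfl⟩ | ⟨hx, s₁, hf, rfl⟩⟩ := h
    · exact .refl
    cases hp
    refine .head (.receive s _ x r p rfl hx hs) ?_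
    have hst₁ : s₁.starved = false := by
      by_contra h
      have h : s₁.starved = true := by simpa using h
      split_ifs at hst
      · rw [starved_tryAdvance h] at hst; cases hst
      · rw [h] at hst; cases hst
    have := micros_flush (ev := .deliver j x r p) hf.1 hst₁
    refine this.1.trans ?_
    split_ifs at hst ⊢ with hm
    · exact micros_tryAdvance (this.2.trans hs) hm hst
    · exact .refl
  | timeout j =>
    obtain ⟨t₀, ht, hnow, rfl⟩ := h
    cases hp
    exact .head (.expire s _ t₀ ht hnow) (micros_tryAdvance (htimer (by simp [ht]))
      (.inl rfl) hst)

/-! ### Monotone components -/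

theorem Micro.dag_mono {a b} (h : Micro c i now ev a b) : a.1.dag ⊆ b.1.dag := by
  cases h with
  | order s p x => rw [(tryOrdering_sameCore c _ _).dag]
  | add => exact Finset.subset_insert _ _
  | start => exact Finset.subset_insert _ _
  | jump => exact Finset.subset_insert _ _
  | advance => exact Finset.subset_insert _ _
  | _ => exact subset_rfl

theorem Micro.sent_mono {a b} (h : Micro c i now ev a b) : a.1.sent ⊆ b.1.sent := by
  cases h with
  | order s p x => rw [(tryOrdering_sameCore c _ _).sent]
  | start => exact Finset.subset_insert _ _
  | jump => exact Finset.subset_insert _ _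
  | advance => exact Finset.subset_insert _ _
  | _ => exact subset_rfl

theorem Micro.committed_mono {a b} (h : Micro c i now ev a b) :
    a.1.committed ⊆ b.1.committed := by
  cases h with
  | order s p x => exact tryOrdering_committed c _ _
  | _ => exact subset_rfl

theorem Micro.known_mono {a b} (h : Micro c i now ev a b) :
    a.1.dag ∪ a.1.buffer ⊆ b.1.dag ∪ b.1.buffer := by
  cases h with
  | order s p x =>
    rw [(tryOrdering_sameCore c _ _).dag, (tryOrdering_sameCore c _ _).buffer]
  | receive => exact Finset.union_subset_union subset_rfl (Finset.subset_insert _ _)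
  | add => intro z; simp; tauto
  | start => intro z; simp [openRound]; tauto
  | jump => intro z; simp [openRound]; tauto
  | advance => intro z; simp [openRound]; tauto
  | _ => exact subset_rfl

theorem Micros.mono {α : Type*} [Preorder α] {F : State P B × Finset (Vertex P B) → α}
    (hF : ∀ a b, Micro c i now ev a b → F a ≤ F b) {a b} (h : Micros c i now ev a b) :
    F a ≤ F b := by
  induction h with
  | refl => exact le_rfl
  | tail _ hab ih => exact ih.trans (hF _ _ hab)

theorem Micros.dag_mono {a b} (h : Micros c i now ev a b) : a.1.dag ⊆ b.1.dag :=
  Micros.mono (F := fun a => a.1.dag) (fun _ _ h => h.dag_mono) h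

theorem Micros.sent_mono {a b} (h : Micros c i now ev a b) : a.1.sent ⊆ b.1.sent :=
  Micros.mono (F := fun a => a.1.sent) (fun _ _ h => h.sent_mono) h

theorem Micros.known_mono {a b} (h : Micros c i now ev a b) :
    a.1.dag ∪ a.1.buffer ⊆ b.1.dag ∪ b.1.buffer :=
  Micros.mono (F := fun a => a.1.dag ∪ a.1.buffer) (fun _ _ h => h.known_mono) h

theorem Micros.committed_mono {a b} (h : Micros c i now ev a b) :
    a.1.committed ⊆ b.1.committed :=
  Micros.mono (F := fun a => a.1.committed) (fun _ _ h => h.committed_mono) h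

/-! ### The state invariant -/

variable (c i)

/-- The number of rounds that a party has entered. -/
def entered (s : State P B) : ℕ := if s.started = true then s.round else 0

/-- A well-formed vertex of the local DAG. -/
def WellFormed (x : Vertex P B) : Prop :=
  2 * c.f + 1 ≤ x.strongEdges.card ∧ (∀ y ∈ x.strongEdges, y.round + 1 = x.round) ∧
    ∀ y ∈ x.weakEdges, y.round + 1 < x.round

/-- The properties that hold of the state of an honest party `i` at all times. -/
structure Inv (a : State P B × Finset (Vertex P B)) : Prop where
  closed : Closed a.1.dag
  genesis : c.genesis ⊆ a.1.dag
  wf : ∀ x ∈ a.1.dag, x ∈ c.genesis ∨ WellFormed c x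
  buffer : ∀ x ∈ a.1.buffer, WellFormed c x
  -- A party that has not started has `round = 1` without having entered any round; this is why
  -- `entered` differs from `round`.
  dormant : a.1.started = false → a.1.dag = c.genesis ∧ a.1.sent = ∅ ∧ a.1.buffer = ∅ ∧
    a.1.timer = none ∧ a.1.round = 1 ∧ a.2 = ∅ ∧ a.1.wait = true
  -- A quorum may lie above the current round only by one, and only while a vertex of its round is
  -- still pending, that is, while the jump is due.
  quorum : ∀ r, 2 * c.f + 1 ≤ (layer a.1.dag r).card → r ≤ a.1.round ∨
    r = a.1.round + 1 ∧ ∃ x ∈ a.2, x.round = r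
  one_le_round : 1 ≤ a.1.round
  sent : ∀ x ∈ a.1.sent, x.source = i ∧ 1 ≤ x.round ∧ x.round ≤ a.1.round ∧ x ∈ a.1.dag
  sent_exists : a.1.started = true → ∀ r, 1 ≤ r → r ≤ a.1.round → ∃ x ∈ a.1.sent, x.round = r
  sent_unique : ∀ x ∈ a.1.sent, ∀ y ∈ a.1.sent, x.round = y.round → x = y
  timer : a.1.started = true → a.1.wait = true → a.1.timer ≠ none
  -- Every round entered consumes exactly one block, so the `q`-th block is proposed in round `q`.
  seq : a.1.seq = entered a.1 + a.1.queue.length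

variable {c i}

theorem WellFormed.one_le_round {x : Vertex P B} (h : WellFormed c x) : 1 ≤ x.round := by
  have : 0 < x.strongEdges.card := by have := h.1; omega
  obtain ⟨y, hy⟩ := Finset.card_pos.1 this
  have := h.2.1 y hy
  omega

theorem WellFormed.quorum_below {x : Vertex P B} {d : Finset (Vertex P B)} (hw : WellFormed c x)
    (hx : x.edges ⊆ d) : 2 * c.f + 1 ≤ (layer d (x.round - 1)).card := by
  refine hw.1.trans (Finset.card_le_card fun y hy => mem_layer.2 ⟨?_, ?_⟩)
  · exact hx (strongEdges_subset_edges _ hy)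
  · have := hw.2.1 y hy
    omega

theorem Legal.wellFormed {x : Vertex P B} {r : ℕ} {p : P} (h : Legal c x r p) :
    WellFormed c x := h.2.2

namespace Inv

variable {a : State P B × Finset (Vertex P B)}

theorem wellFormed (h : Inv c i a) {x : Vertex P B} (hx : x ∈ a.1.dag) (h1 : 1 ≤ x.round) :
    WellFormed c x := by
  rcases h.wf x hx with hg | hw
  · have := c.genesis_round x hg
    omega
  · exact hw

theorem layer_zero (h : Inv c i a) : 2 * c.f + 1 ≤ (layer a.1.dag 0).card := by
  rw [← c.genesis_card]
  exact Finset.card_le_card fun x hx => mem_layer.2 ⟨h.genesis hx, c.genesis_round x hx⟩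

/-- Start, jump and advance all open the round after the last one entered, which permits a single
verification for the three. -/
theorem openRound {s : State P B} {p : Finset (Vertex P B)} (h : Inv c i (s, p))
    {r : ℕ} {b : B} {q : List B} (hq : s.queue = b :: q) (hr : r = entered s + 1)
    (hl : 2 * c.f + 1 ≤ (layer s.dag (r - 1)).card)
    (hp : ∀ r', 2 * c.f + 1 ≤ (layer s.dag r').card → r' ≤ r) :
    Inv c i (openRound i now r b q { s with started := true },
      insert (createVertex i r b s.dag) p) := by
  have hsub := createVertex_edges_subset i r b s.dag
  have hwf : WellFormed c (createVertex i r b s.dag) := by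
    refine ⟨by rwa [createVertex_strongEdges], fun y hy => ?_, fun y hy => ?_⟩
    · rw [createVertex_strongEdges] at hy
      have := (mem_layer.1 hy).2
      simp only [createVertex_round]
      omega
    · exact (createVertex_weakEdges_round i r b s.dag hy).2
  have hent : ∀ x ∈ s.sent, x.round < r := by
    intro x hx
    cases hs : s.started
    · rw [(h.dormant hs).2.1] at hx; simp at hx
    · have := (h.sent x hx).2.2.1
      simp only [entered, hs, if_true] at hr
      dsimp only at this
      omega
  constructor
  · exact h.closed.insert hsub
  · exact h.genesis.trans (Finset.subset_insert _ _)
  · intro x hx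
    rcases Finset.mem_insert.1 hx with rfl | hx
    · exact .inr hwf
    · exact h.wf x hx
  · intro x hx
    exact h.buffer x (Finset.mem_of_mem_erase hx)
  · intro hs
    simp [Bullshark.openRound] at hs
  · intro r' hr'
    left
    by_cases hrr : r = r'
    · exact hrr.ge
    · apply hp
      rwa [← layer_insert_of_ne (x := createVertex i r b s.dag) (by simpa using hrr)]
  · show 1 ≤ r
    omega
  · intro x hx
    rcases Finset.mem_insert.1 hx with rfl | hx
    · exact ⟨rfl, by simp; omega, le_rfl, Finset.mem_insert_self _ _⟩
    · have := h.sent x hx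
      exact ⟨this.1, this.2.1, (hent x hx).le, Finset.mem_insert_of_mem this.2.2.2⟩
  · intro _ r' h1 h2
    have h2 : r' ≤ r := h2
    rcases h2.lt_or_eq with h2 | rfl
    · cases hs : s.started
      · simp [entered, hs] at hr; omega
      · simp only [entered, hs, if_true] at hr
        obtain ⟨x, hx, hxr⟩ := h.sent_exists hs r' h1 (show r' ≤ s.round by omega)
        exact ⟨x, Finset.mem_insert_of_mem hx, hxr⟩
    · exact ⟨_, Finset.mem_insert_self _ _, rfl⟩
  · intro x hx y hy hxy
    rcases Finset.mem_insert.1 hx with rfl | hx <;> rcases Finset.mem_insert.1 hy with rfl | hy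
    · rfl
    · have := hent y hy; simp at hxy; omega
    · have := hent x hx; simp at hxy; omega
    · exact h.sent_unique x hx y hy hxy
  · intro _ _
    simp [Bullshark.openRound]
  · have := h.seq
    simp only [hq, List.length_cons] at this
    simp only [Bullshark.openRound, entered, if_true] at this ⊢
    simp only [entered] at hr
    omega

theorem started_of_mem (h : Inv c i a) {x : Vertex P B} (hx : x ∈ a.1.dag) (h1 : 1 ≤ x.round) :
    a.1.started = true := by
  by_contra hs
  rw [(h.dormant (by simpa using hs)).1] at hx
  have := c.genesis_round x hx
  omega

theorem layer_dormant (h : Inv c i a) (hs : a.1.started = false) {r : ℕ}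
    (hr : 2 * c.f + 1 ≤ (layer a.1.dag r).card) : r = 0 := by
  obtain ⟨x, hx⟩ := Finset.card_pos.1 (by omega : 0 < (layer a.1.dag r).card)
  have hx := mem_layer.1 hx
  rw [← hx.2, c.genesis_round x ((h.dormant hs).1 ▸ hx.1)]

/-- Jumps skip no round, since `Inv.quorum` admits no quorum further up. Before the start only round
`0` is populated. -/
theorem jump_eq (h : Inv c i a) {r : ℕ} (hr : a.1.round < r)
    (hl : 2 * c.f + 1 ≤ (layer a.1.dag r).card) : r = a.1.round + 1 ∧ a.1.started = true := by
  refine ⟨?_, ?_⟩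
  · rcases h.quorum r hl with h | h <;> omega
  · by_contra hs
    have := h.layer_dormant (by simpa using hs) hl
    omega

theorem micro {b : State P B × Finset (Vertex P B)} (h : Inv c i a) (hab : Micro c i now ev a b) :
    Inv c i b := by
  cases hab with
  | enqueue s p b k hev hk =>
    refine { h with seq := ?_, dormant := h.dormant }
    have := h.seq
    simp only [List.length_append, List.length_singleton, entered] at this ⊢
    omega
  | expire s p t₀ ht hnow =>
    refine { h with timer := by simp, dormant := fun hs => ?_, seq := h.seq }
    have := (h.dormant hs).2.2.2.1
    dsimp only at this
    rw [this] at ht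
    cases ht
  | receive s p x r q hev hx hs =>
    refine { h with buffer := ?_, dormant := ?_, seq := h.seq }
    · intro y hy
      rcases Finset.mem_insert.1 hy with rfl | hy
      · exact hx.wellFormed
      · exact h.buffer y hy
    · intro hs'
      dsimp only at hs'
      rw [hs] at hs'; cases hs'
  | add s x hx hr =>
    have hwf := h.buffer x hx
    constructor
    · exact h.closed.insert hr
    · exact h.genesis.trans (Finset.subset_insert _ _)
    · intro y hy
      rcases Finset.mem_insert.1 hy with rfl | hy
      · exact .inr hwf
      · exact h.wf y hy
    · intro y hy
      exact h.buffer y (Finset.mem_of_mem_erase hy)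
    · intro hs
      have := (h.dormant hs).2.2.1
      dsimp only at this
      rw [this] at hx
      simp at hx
    · intro r hl
      dsimp only at hl ⊢
      by_cases hxr : x.round = r
      -- The references of `x` fill the round below it. As nothing is pending, that round is at most
      -- the current one, so `x` can complete a quorum at most one round further up.
      · have := h.quorum _ (hwf.quorum_below hr)
        simp only [Finset.notMem_empty, false_and, exists_false, and_false, or_false] at this
        by_cases hrr : r ≤ s.round
        · exact .inl hrr
        · exact .inr ⟨by omega, x, by simp, hxr⟩
      · rw [layer_insert_of_ne hxr] at hl
        have := h.quorum r hl
        simp only [Finset.notMem_empty, false_and, exists_false, and_false, or_false] at this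
        exact .inl this
    · exact h.one_le_round
    · intro y hy
      have := h.sent y hy
      exact ⟨this.1, this.2.1, this.2.2.1, Finset.mem_insert_of_mem this.2.2.2⟩
    · exact h.sent_exists
    · exact h.sent_unique
    · exact h.timer
    · exact h.seq
  | start s p b q hq hs =>
    refine h.openRound hq (by simp [entered, hs]) h.layer_zero fun r' hr' => ?_
    have := h.layer_dormant hs hr'
    omega
  | jump s p r b q hq hr hl =>
    obtain ⟨h1, h2⟩ := h.jump_eq hr hl
    dsimp only at h1 h2
    have hs : s = { s with started := true } := by rw [← h2]
    rw [hs]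
    refine h.openRound hq (by simp [entered, h2, h1]) ?_ fun r' hr' => ?_
    · obtain ⟨x, hx⟩ := Finset.card_pos.1 (by omega : 0 < (layer s.dag r).card)
      have hx := mem_layer.1 hx
      rw [← hx.2]
      exact (h.wellFormed hx.1 (by omega)).quorum_below (h.closed x hx.1)
    · rcases h.quorum r' hr' with h | h <;> dsimp only at h <;> omega
  | advance s p b q hq hm hl hs =>
    have hs' : s = { s with started := true } := by rw [← hs]
    have := h.openRound (now := now) (r := s.round + 1) hq (by simp [entered, hs])
      (by simpa using hl) fun r' hr' => by
      rcases h.quorum r' hr' with h | h <;> dsimp only at h <;> omega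
    rwa [← hs'] at this
  | order s p x hx hr =>
    obtain ⟨e1, e2, e3, e4, e5, e6, e7, e8, e9, e10⟩ := tryOrdering_sameCore c s x
    constructor <;> simp only [e1, e2, e3, e4, e5, e6, e7, e8, e10, entered]
    · exact h.closed
    · exact h.genesis
    · exact h.wf
    · exact h.buffer
    · intro hs
      have := h.dormant hs
      dsimp only at this
      refine ⟨this.1, this.2.1, this.2.2.1, this.2.2.2.1, this.2.2.2.2.1, ?_, this.2.2.2.2.2.2⟩
      rw [this.2.2.2.2.2.1]; simp
    · intro r hl
      rcases h.quorum r hl with h | ⟨h, y, hy, hyr⟩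
      · exact .inl h
      · by_cases hyx : y = x
        -- If the vertex announcing the jump were the one being ordered, the jump would still be
        -- due, against the side condition of `order`.
        · subst hyx
          rw [hyr] at hr
          exact absurd ⟨hl, by dsimp only at h; omega⟩ hr
        · exact .inr ⟨h, y, Finset.mem_erase.2 ⟨hyx, hy⟩, hyr⟩
    · exact h.one_le_round
    · exact h.sent
    · exact h.sent_exists
    · exact h.sent_unique
    · exact h.timer
    · exact h.seq

theorem micros {b : State P B × Finset (Vertex P B)} (h : Inv c i a)
    (hab : Micros c i now ev a b) : Inv c i b := by
  induction hab with
  | refl => exact h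
  | tail _ hab ih => exact ih.micro hab

end Inv

theorem inv_initial : Inv c i (initialState c, ∅) := by
  constructor <;> simp only [initialState]
  · intro x hx
    rw [c.genesis_edges x hx]; simp
  · exact subset_rfl
  · exact fun x hx => .inl hx
  · simp
  · simp
  · intro r hr
    obtain ⟨x, hx⟩ := Finset.card_pos.1 (by omega : 0 < (layer c.genesis r).card)
    have hx := mem_layer.1 hx
    have := c.genesis_round x hx.1
    omega
  · exact le_rfl
  · simp
  · simp
  · simp
  · simp
  · simp [entered]

end

section

variable {P : Type u} {B : Type v} [Fintype P] {c : Setup P B} {i : P} {now : ℝ} {ev : Event P B}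

/-! ### Entering a round -/

variable (c i now) in
/-- In passing from `a` to `b`, party `i` enters round `x.round` with its new vertex `x`. -/
structure Opens (a b : State P B × Finset (Vertex P B)) (x : Vertex P B) : Prop where
  started : b.1.started = true
  round : b.1.round = x.round
  timer : b.1.timer = some now
  wait : b.1.wait = true
  queue : a.1.queue = x.block :: b.1.queue
  dag : b.1.dag = insert x a.1.dag
  buffer : b.1.buffer ⊆ a.1.buffer
  sent : b.1.sent = insert x a.1.sent
  pending : b.2 = insert x a.2
  committed : b.1.committed = a.1.committed
  delivered : b.1.delivered = a.1.delivered
  output : b.1.output = a.1.output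
  round_eq : x.round = entered a.1 + 1
  vertex : x = createVertex i x.round x.block a.1.dag
  quorum : 2 * c.f + 1 ≤ (layer a.1.dag (x.round - 1)).card
  reason : x.round = 1 ∨ 2 * c.f + 1 ≤ (layer a.1.dag x.round).card ∨
    a.1.round = x.round - 1 ∧ MayAdvance c a.1
  fresh : ∀ y ∈ a.1.sent, y.round < x.round

variable (c now) in
/-- No round is entered in passing from `a` to `b`. -/
structure Stays (a b : State P B × Finset (Vertex P B)) : Prop where
  sent : b.1.sent = a.1.sent
  round : b.1.round = a.1.round
  started : b.1.started = a.1.started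
  timer : (b.1.timer = a.1.timer ∧ b.1.wait = a.1.wait) ∨
    ∃ t₀, a.1.timer = some t₀ ∧ now = t₀ + c.timeout ∧ b.1.timer = none
  queue : a.1.queue <+: b.1.queue

/-- Later inductions on timers and queues need only this dichotomy instead of all eight kinds of
steps. -/
theorem Micro.opens_or_stays {a b : State P B × Finset (Vertex P B)} (hab : Micro c i now ev a b)
    (ha : Inv c i a) : (∃ x, Opens c i now a b x) ∨ Stays c now a b := by
  have key : ∀ (s : State P B) (p : Finset (Vertex P B)) (r : ℕ) (b : B) (q : List B),
      Inv c i (s, p) → s.queue = b :: q → r = entered s + 1 →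
      2 * c.f + 1 ≤ (layer s.dag (r - 1)).card →
      (r = 1 ∨ 2 * c.f + 1 ≤ (layer s.dag r).card ∨ s.round = r - 1 ∧ MayAdvance c s) →
      Opens c i now (s, p) (openRound i now r b q { s with started := true },
        insert (createVertex i r b s.dag) p) (createVertex i r b s.dag) := by
    intro s p r b q hs hq hr hl hreason
    refine ⟨rfl, rfl, rfl, rfl, hq, rfl, Finset.erase_subset _ _, rfl, rfl, rfl, rfl, rfl, hr,
      rfl, hl, hreason, fun y hy => ?_⟩
    cases h : s.started
    · have := (hs.dormant h).2.1
      dsimp only at this hy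
      rw [this] at hy; simp at hy
    · have := (hs.sent y hy).2.2.1
      simp only [entered, h, if_true] at hr
      simp only [createVertex_round]
      dsimp only at this
      omega
  cases hab with
  | start s p b q hq hs =>
    exact .inl ⟨_, key s p 1 b q ha hq (by simp [entered, hs]) ha.layer_zero (.inl rfl)⟩
  | jump s p r b q hq hr hl =>
    obtain ⟨h1, h2⟩ := ha.jump_eq hr hl
    dsimp only at h1 h2
    have hs : s = { s with started := true } := by rw [← h2]
    refine .inl ⟨createVertex i r b s.dag, ?_⟩
    have := key s p r b q ha hq (by simp [entered, h2, h1]) ?_ (.inr (.inl hl))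
    · rwa [← hs] at this
    · obtain ⟨x, hx⟩ := Finset.card_pos.1 (by omega : 0 < (layer s.dag r).card)
      have hx := mem_layer.1 hx
      rw [← hx.2]
      exact (ha.wellFormed hx.1 (by omega)).quorum_below (ha.closed x hx.1)
  | advance s p b q hq hm hl hs =>
    have hs' : s = { s with started := true } := by rw [← hs]
    refine .inl ⟨createVertex i (s.round + 1) b s.dag, ?_⟩
    have := key s p (s.round + 1) b q ha hq (by simp [entered, hs]) (by simpa using hl)
      (.inr (.inr ⟨by simp, hm⟩))
    rwa [← hs'] at this
  | order s p x =>
    have h := tryOrdering_sameCore c s x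
    exact .inr ⟨h.sent, h.round, h.started, .inl ⟨h.timer, h.wait⟩,
      ⟨[], by simpa using h.queue.symm⟩⟩
  | expire s p t₀ ht hnow => exact .inr ⟨rfl, rfl, rfl, .inr ⟨t₀, ht, hnow, rfl⟩, List.prefix_rfl⟩
  | enqueue s p b k => exact .inr ⟨rfl, rfl, rfl, .inl ⟨rfl, rfl⟩, List.prefix_append _ _⟩
  | _ => exact .inr ⟨rfl, rfl, rfl, .inl ⟨rfl, rfl⟩, List.prefix_rfl⟩

/-! ### Executions as chains of elementary steps -/

namespace Execution

variable (e : Execution c)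

/-- The assumptions of an execution that do not involve time. -/
structure Regular : Prop where
  neverStarved : e.NeverStarved
  broadcast : e.ReliableBroadcast

/-- `a` occurs at party `i` during the `n`-th event. -/
structure Reach (i : P) (n : ℕ) (a : State P B × Finset (Vertex P B)) : Prop where
  before : Micros c i (e.time n) (e.event n) (e.state n i, ∅) a
  after : Micros c i (e.time n) (e.event n) a (e.state (n + 1) i, ∅)

/-- Party `i` enters round `r` during the `n`-th event. -/
def Enters (n : ℕ) (i : P) (r : ℕ) : Prop := ∃ x, e.RBcast n i x ∧ x.round = r

variable {e}

/-- The decomposition of a timeout needs that a running timer belongs to a started party. This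
follows from the invariant, which is itself propagated along the decomposition; hence it is a
hypothesis here and removed in `micros_state`. -/
theorem micros_state_of_inv (hq : e.NeverStarved) (hi : e.Honest i) (n : ℕ)
    (h : Inv c i (e.state n i, ∅)) :
    Micros c i (e.time n) (e.event n) (e.state n i, ∅) (e.state (n + 1) i, ∅) := by
  by_cases hp : (e.event n).party = i
  · refine micros_of_step (e.state_step n i hi hp) hp (hq _ _ hi) fun ht => ?_
    by_contra hs
    exact ht (h.dormant (by simpa using hs)).2.2.2.1
  · rw [e.state_idle n i hi hp]

theorem inv_state (hq : e.NeverStarved) (hi : e.Honest i) (n : ℕ) :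
    Inv c i (e.state n i, ∅) := by
  induction n with
  | zero => rw [e.state_zero i hi]; exact inv_initial
  | succ n ih => exact ih.micros (micros_state_of_inv hq hi n ih)

theorem micros_state (hq : e.NeverStarved) (hi : e.Honest i) (n : ℕ) :
    Micros c i (e.time n) (e.event n) (e.state n i, ∅) (e.state (n + 1) i, ∅) :=
  micros_state_of_inv hq hi n (inv_state hq hi n)

theorem Reach.inv (hq : e.NeverStarved) (hi : e.Honest i) {n : ℕ}
    {a : State P B × Finset (Vertex P B)} (h : e.Reach i n a) : Inv c i a :=
  (inv_state hq hi n).micros h.before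

/-- Induction over all intermediate states of one party. `hnext` identifies the end of an event with
the beginning of the next one. -/
theorem reach_induction (hq : e.NeverStarved) (hi : e.Honest i)
    {Q : ℕ → State P B × Finset (Vertex P B) → Prop} (h0 : Q 0 (initialState c, ∅))
    (hstep : ∀ n a b, e.Reach i n a → e.Reach i n b → Micro c i (e.time n) (e.event n) a b →
      Q n a → Q n b)
    (hnext : ∀ n s, Q n (s, ∅) → Q (n + 1) (s, ∅)) {n : ℕ}
    {a : State P B × Finset (Vertex P B)} (ha : e.Reach i n a) : Q n a := by
  have key : ∀ n, Q n (e.state n i, ∅) → ∀ a, e.Reach i n a → Q n a := by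
    intro n hn a ha
    obtain ⟨h1, h2⟩ := ha
    induction h1 with
    | refl => exact hn
    | tail h1 hab ih =>
      have h3 := h2.head hab
      exact hstep n _ _ ⟨h1, h3⟩ ⟨h1.tail hab, h2⟩ hab (ih h3)
  have hstate : ∀ n, Q n (e.state n i, ∅) := by
    intro n
    induction n with
    | zero => rw [e.state_zero i hi]; exact h0
    | succ n ih => exact hnext n _ (key n ih _ ⟨micros_state hq hi n, .refl⟩)
  exact key n (hstate n) a ha

theorem reach_state (hq : e.NeverStarved) (hi : e.Honest i) (n : ℕ) :
    e.Reach i n (e.state n i, ∅) := ⟨.refl, micros_state hq hi n⟩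

/-! ### Monotonicity in time -/

theorem dag_mono (hq : e.NeverStarved) (hi : e.Honest i) {m n : ℕ} (h : m ≤ n) :
    (e.state m i).dag ⊆ (e.state n i).dag :=
  monotone_nat_of_le_succ (f := fun n => (e.state n i).dag)
    (fun n => (micros_state hq hi n).dag_mono) h

theorem sent_mono (hq : e.NeverStarved) (hi : e.Honest i) {m n : ℕ} (h : m ≤ n) :
    (e.state m i).sent ⊆ (e.state n i).sent :=
  monotone_nat_of_le_succ (f := fun n => (e.state n i).sent)
    (fun n => (micros_state hq hi n).sent_mono) h

theorem committed_mono (hq : e.NeverStarved) (hi : e.Honest i) {m n : ℕ} (h : m ≤ n) :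
    (e.state m i).committed ⊆ (e.state n i).committed :=
  monotone_nat_of_le_succ (f := fun n => (e.state n i).committed)
    (fun n => (micros_state hq hi n).committed_mono) h

theorem known_mono (hq : e.NeverStarved) (hi : e.Honest i) {m n : ℕ} (h : m ≤ n) :
    (e.state m i).dag ∪ (e.state m i).buffer ⊆ (e.state n i).dag ∪ (e.state n i).buffer :=
  monotone_nat_of_le_succ (f := fun n => (e.state n i).dag ∪ (e.state n i).buffer)
    (fun n => (micros_state hq hi n).known_mono) h

theorem exists_rbcast_of_mem_sent (hi : e.Honest i) {n : ℕ} {x : Vertex P B}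
    (h : x ∈ (e.state n i).sent) : ∃ m < n, e.RBcast m i x := by
  induction n with
  | zero => rw [e.state_zero i hi] at h; simp [initialState] at h
  | succ n ih =>
    by_cases hx : x ∈ (e.state n i).sent
    · obtain ⟨m, hm, hb⟩ := ih hx
      exact ⟨m, by omega, hb⟩
    · exact ⟨n, by omega, hx, h⟩

theorem RBcast.unique (hq : e.NeverStarved) (hi : e.Honest i) {m n : ℕ} {x y : Vertex P B}
    (hx : e.RBcast m i x) (hy : e.RBcast n i y) (hxy : x.round = y.round) : m = n ∧ x = y := by
  have hxy : x = y := by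
    have h1 := sent_mono hq hi (le_max_left (m + 1) (n + 1)) hx.2
    have h2 := sent_mono hq hi (le_max_right (m + 1) (n + 1)) hy.2
    exact (inv_state hq hi _).sent_unique x h1 y h2 hxy
  subst hxy
  refine ⟨?_, rfl⟩
  rcases lt_trichotomy m n with h | h | h
  · exact absurd (sent_mono hq hi h hx.2) hy.1
  · exact h
  · exact absurd (sent_mono hq hi h hy.2) hx.1

theorem Enters.unique (hq : e.NeverStarved) (hi : e.Honest i) {m n r : ℕ}
    (hm : e.Enters m i r) (hn : e.Enters n i r) : m = n := by
  obtain ⟨x, hx, rfl⟩ := hm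
  obtain ⟨y, hy, h⟩ := hn
  exact (hx.unique hq hi hy h.symm).1

theorem Enters.state (hq : e.NeverStarved) (hi : e.Honest i) {m n r : ℕ}
    (h : e.Enters m i r) (hmn : m < n) : (e.state n i).started = true ∧ 1 ≤ r ∧
      r ≤ (e.state n i).round := by
  obtain ⟨x, hx, rfl⟩ := h
  have h := (inv_state hq hi n).sent x (sent_mono hq hi hmn hx.2)
  exact ⟨(inv_state hq hi n).started_of_mem h.2.2.2 h.2.1, h.2.1, h.2.2.1⟩

theorem exists_enters (hq : e.NeverStarved) (hi : e.Honest i) {n r : ℕ}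
    (hs : (e.state n i).started = true) (h1 : 1 ≤ r) (hr : r ≤ (e.state n i).round) :
    ∃ m < n, e.Enters m i r := by
  obtain ⟨x, hx, hxr⟩ := (inv_state hq hi n).sent_exists hs r h1 hr
  obtain ⟨m, hm, hb⟩ := exists_rbcast_of_mem_sent hi hx
  exact ⟨m, hm, x, hb, hxr⟩

theorem Enters.le (hq : e.NeverStarved) (hi : e.Honest i) {m n r r' : ℕ}
    (h : e.Enters m i r) (h' : e.Enters n i r') (hr1 : 1 ≤ r) (hr : r ≤ r') : m ≤ n := by
  have h2 := h'.state hq hi (Nat.lt_succ_self n)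
  obtain ⟨k, hk, hb⟩ := exists_enters hq hi h2.1 hr1 (hr.trans h2.2.2)
  rw [h.unique hq hi hb]
  omega

/-! ### Timers -/

theorem Reach.rbcast {n : ℕ} {a b : State P B × Finset (Vertex P B)} {x : Vertex P B}
    (ha : e.Reach i n a) (hb : e.Reach i n b) (h : Opens c i (e.time n) a b x) :
    e.RBcast n i x := by
  refine ⟨fun hx => ?_, hb.after.sent_mono ?_⟩
  · exact lt_irrefl _ (h.fresh x (ha.before.sent_mono hx))
  · rw [h.sent]; exact Finset.mem_insert_self _ _

/-- The two clauses are proved together: when the timer expires, the second one inherits its entry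
event from the first. -/
theorem Reach.timer (hq : e.NeverStarved) (hi : e.Honest i) {n : ℕ}
    {a : State P B × Finset (Vertex P B)} (ha : e.Reach i n a) :
    (∀ t₀, a.1.timer = some t₀ → ∃ m ≤ n, e.time m = t₀ ∧ e.Enters m i a.1.round) ∧
    (a.1.wait = false → ∃ m ≤ n, e.Enters m i a.1.round ∧ e.time m + c.timeout ≤ e.time n) := by
  refine reach_induction hq hi (Q := fun n a =>
    (∀ t₀, a.1.timer = some t₀ → ∃ m ≤ n, e.time m = t₀ ∧ e.Enters m i a.1.round) ∧
    (a.1.wait = false → ∃ m ≤ n, e.Enters m i a.1.round ∧ e.time m + c.timeout ≤ e.time n))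
    ?_ ?_ ?_ ha
  · simp [initialState]
  · intro n a b ha hb hab h
    rcases hab.opens_or_stays (ha.inv hq hi) with ⟨x, hx⟩ | hx
    · rw [hx.timer, hx.wait, hx.round]
      refine ⟨fun t₀ ht => ⟨n, le_rfl, by simpa using ht, x, ha.rbcast hb hx, rfl⟩, by simp⟩
    · rw [hx.round]
      obtain ⟨h1, h2⟩ | ⟨t₀, h1, h2, h3⟩ := hx.timer
      · rwa [h1, h2]
      · rw [h3]
        refine ⟨by simp, fun _ => ?_⟩
        obtain ⟨m, hm, hmt, hme⟩ := h.1 t₀ h1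
        exact ⟨m, hm, hme, by rw [hmt, h2]⟩
  · intro n s h
    refine ⟨fun t₀ ht => ?_, fun hw => ?_⟩
    · obtain ⟨m, hm, h⟩ := h.1 t₀ ht
      exact ⟨m, by omega, h⟩
    · obtain ⟨m, hm, h, h'⟩ := h.2 hw
      exact ⟨m, by omega, h, h'.trans (e.time_mono (Nat.le_succ n))⟩

/-! ### The origin of the vertices of a DAG -/

theorem Reach.known (hq : e.NeverStarved) (hi : e.Honest i) {n : ℕ}
    {a : State P B × Finset (Vertex P B)} (ha : e.Reach i n a) :
    (∀ x ∈ a.1.buffer, ∃ m ≤ n, e.event m = .deliver i x x.round x.source) ∧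
    ∀ x ∈ a.1.dag, 1 ≤ x.round →
      x ∈ a.1.sent ∨ ∃ m ≤ n, e.event m = .deliver i x x.round x.source := by
  refine reach_induction hq hi (Q := fun n a =>
    (∀ x ∈ a.1.buffer, ∃ m ≤ n, e.event m = .deliver i x x.round x.source) ∧
    ∀ x ∈ a.1.dag, 1 ≤ x.round →
      x ∈ a.1.sent ∨ ∃ m ≤ n, e.event m = .deliver i x x.round x.source) ?_ ?_ ?_ ha
  · refine ⟨by simp [initialState], fun x hx h1 => ?_⟩
    have := c.genesis_round x hx
    omega
  · intro n a b ha hb hab h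
    rcases hab.opens_or_stays (ha.inv hq hi) with ⟨x, hx⟩ | hx
    · refine ⟨fun y hy => h.1 y (hx.buffer hy), fun y hy h1 => ?_⟩
      rw [hx.dag] at hy
      rw [hx.sent]
      rcases Finset.mem_insert.1 hy with rfl | hy
      · exact .inl (Finset.mem_insert_self _ _)
      · exact (h.2 y hy h1).imp_left (Finset.mem_insert_of_mem)
    · rw [hx.sent]
      cases hab with
      | start => exact ⟨fun y hy => h.1 y (Finset.mem_of_mem_erase hy), fun y hy h1 => by
          have := hx.started; simp_all [openRound]⟩
      | jump s p r b q hq hr => have := hx.round; simp [openRound] at this; omega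
      | advance => have := hx.round; simp [openRound] at this
      | order s p x =>
        rw [(tryOrdering_sameCore c s x).buffer, (tryOrdering_sameCore c s x).dag]
        exact h
      | receive s p x r q hev hl =>
        refine ⟨fun y hy => ?_, h.2⟩
        rcases Finset.mem_insert.1 hy with rfl | hy
        · exact ⟨n, le_rfl, by rw [hev, hl.1, hl.2.1]⟩
        · exact h.1 y hy
      | add s x hxb =>
        refine ⟨fun y hy => h.1 y (Finset.mem_of_mem_erase hy), fun y hy h1 => ?_⟩
        rcases Finset.mem_insert.1 hy with rfl | hy
        · exact .inr (h.1 y hxb)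
        · exact h.2 y hy h1
      | _ => exact h
  · intro n s h
    refine ⟨fun x hx => ?_, fun x hx h1 => (h.2 x hx h1).imp_right ?_⟩
    · obtain ⟨m, hm, h⟩ := h.1 x hx
      exact ⟨m, by omega, h⟩
    · rintro ⟨m, hm, h⟩
      exact ⟨m, by omega, h⟩

/-- A party adds its own vertices on creation, without a delivery; Validity of the broadcast
delivers them to it as well. -/
theorem exists_deliver_of_mem_dag (he : e.Regular) (hi : e.Honest i) {n : ℕ} {x : Vertex P B}
    (hx : x ∈ (e.state n i).dag) (h1 : 1 ≤ x.round) :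
    ∃ m, e.event m = .deliver i x x.round x.source := by
  rcases ((reach_state he.neverStarved hi n).known he.neverStarved hi).2 x hx h1 with h | ⟨m, -, h⟩
  · obtain ⟨m, -, hm⟩ := exists_rbcast_of_mem_sent hi h
    rw [((inv_state he.neverStarved hi n).sent x h).1]
    exact he.broadcast.validity m i i x hi hi hm
  · exact ⟨m, h⟩

/-- Honest parties do not see two vertices of the same round and source. -/
theorem dag_unique (he : e.Regular) {j : P} (hi : e.Honest i) (hj : e.Honest j) {m n : ℕ}
    {x y : Vertex P B} (hx : x ∈ (e.state m i).dag) (hy : y ∈ (e.state n j).dag)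
    (h1 : 1 ≤ x.round) (hr : y.round = x.round) (hs : y.source = x.source) : y = x := by
  obtain ⟨k, hk⟩ := exists_deliver_of_mem_dag he hi hx h1
  obtain ⟨l, hl⟩ := exists_deliver_of_mem_dag he hj hy (hr ▸ h1)
  obtain ⟨l', hl'⟩ := he.broadcast.agreement l j i _ _ _ hj hi hl
  rw [hr, hs] at hl'
  have := he.broadcast.integrity k l' i x y _ _ hi hk hl'
  rw [← this, hk] at hl'
  injection hl' with _ h
  exact h.symm

/-- A vertex with an honest source in the DAG of an honest party has been broadcast. -/
theorem Reach.mem_sent_of_honest (he : e.Regular) (hi : e.Honest i) {n : ℕ}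
    {a : State P B × Finset (Vertex P B)} (ha : e.Reach i n a) {x : Vertex P B}
    (hx : x ∈ a.1.dag) (h1 : 1 ≤ x.round) (hs : e.Honest x.source) :
    x ∈ a.1.sent ∨ x ∈ (e.state n x.source).sent := by
  refine ((ha.known he.neverStarved hi).2 x hx h1).imp_right ?_
  rintro ⟨m, hm, hev⟩
  exact sent_mono he.neverStarved hs hm (he.broadcast.authenticity m i x _ _ hi hs hev).2

theorem mem_sent_of_honest (he : e.Regular) (hi : e.Honest i) {n : ℕ} {x : Vertex P B}
    (hx : x ∈ (e.state n i).dag) (h1 : 1 ≤ x.round) (hs : e.Honest x.source) :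
    x ∈ (e.state n x.source).sent := by
  rcases (reach_state he.neverStarved hi n).mem_sent_of_honest he hi hx h1 hs with h | h
  · rwa [((inv_state he.neverStarved hi n).sent x h).1]
  · exact h

/-- A quorum in a layer contains more than `f` vertices of honest parties. -/
theorem card_honest_layer (he : e.Regular) (hi : e.Honest i) {n r : ℕ}
    {d : Finset (Vertex P B)} (hd : d ⊆ (e.state n i).dag) (hr : 1 ≤ r)
    (hl : 2 * c.f + 1 ≤ (layer d r).card) :
    c.f + 1 ≤ ((layer d r).filter fun x => e.Honest x.source).card := by
  -- By `dag_unique` the source is injective on the layer, so corrupted parties contribute at most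
  -- `f` vertices.
  have h1 : ((layer d r).filter fun x => ¬ e.Honest x.source).card ≤ c.f := by
    refine le_trans ?_ e.card_corrupted
    refine Finset.card_le_card_of_injOn Vertex.source (fun x hx => ?_) fun x hx y hy hxy => ?_
    · simpa [Honest] using (Finset.mem_filter.1 hx).2
    · have hx := mem_layer.1 (Finset.mem_filter.1 hx).1
      have hy := mem_layer.1 (Finset.mem_filter.1 hy).1
      exact dag_unique he hi hi (hd hy.1) (hd hx.1) (by omega) (by omega) hxy
  have h2 := Finset.card_filter_add_card_filter_not (s := layer d r) (fun x => e.Honest x.source)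
  omega

theorem card_honest (e : Execution c) :
    2 * c.f + 1 ≤ (Finset.univ.filter fun p => e.Honest p).card := by
  have h1 : (Finset.univ.filter fun p => ¬ e.Honest p) = e.corrupted := by
    ext p; simp [Honest]
  have h2 := Finset.card_filter_add_card_filter_not (s := (Finset.univ : Finset P))
    (fun p => e.Honest p)
  rw [h1, Finset.card_univ] at h2
  have := e.card_corrupted
  have := c.card_parties
  omega

/-- The circumstances in which party `i` creates its vertex `x` during the `n`-th event, with
local DAG `d`. -/
structure Origin (e : Execution c) (n : ℕ) (i : P) (x : Vertex P B) (d : Finset (Vertex P B)) :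
    Prop where
  le : (e.state n i).dag ⊆ d
  ge : d ⊆ (e.state (n + 1) i).dag
  closed : Closed d
  vertex : x = createVertex i x.round x.block d
  quorum : 2 * c.f + 1 ≤ (layer d (x.round - 1)).card
  -- The alternatives are: the start; a jump, reduced to one honest vertex of the same round
  -- broadcast in a strictly earlier event; an expired timer; the condition of the round met while
  -- the timer is running.
  reason : x.round = 1 ∨
    (∃ y ∈ d, y.round = x.round ∧ e.Honest y.source ∧ ∃ m < n, e.RBcast m y.source y) ∨
    (∃ m ≤ n, e.Enters m i (x.round - 1) ∧ e.time m + c.timeout ≤ e.time n) ∨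
    ∃ s : State P B, s.dag = d ∧ s.round = x.round - 1 ∧ s.wait = true ∧ MayAdvance c s

theorem Origin.strongEdges {n : ℕ} {x : Vertex P B} {d : Finset (Vertex P B)}
    (h : Origin e n i x d) : x.strongEdges = layer d (x.round - 1) := by
  rw [h.vertex, createVertex_strongEdges, createVertex_round]

/-- Inside the event there is an elementary step in which `x` joins `sent`. It must open a round,
and `d` is the DAG just before that step. -/
theorem RBcast.origin (he : e.Regular) (hi : e.Honest i) {n : ℕ} {x : Vertex P B}
    (h : e.RBcast n i x) : ∃ d, Origin e n i x d := by
  have hq := he.neverStarved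
  have key : ∀ a, Micros c i (e.time n) (e.event n) (e.state n i, ∅) a → x ∈ a.1.sent →
      ∃ a' b', Micros c i (e.time n) (e.event n) (e.state n i, ∅) a' ∧
        Micro c i (e.time n) (e.event n) a' b' ∧
        Micros c i (e.time n) (e.event n) b' a ∧ x ∉ a'.1.sent ∧ x ∈ b'.1.sent := by
    intro a ha hx
    induction ha with
    | refl => exact absurd hx h.1
    | tail h1 hab ih =>
      rename_i a b
      by_cases hxa : x ∈ a.1.sent
      · obtain ⟨a', b', h2, h3, h4, h5⟩ := ih hxa
        exact ⟨a', b', h2, h3, h4.tail hab, h5⟩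
      · exact ⟨a, b, h1, hab, .refl, hxa, hx⟩
  obtain ⟨a, b, h1, hab, h2, hxa, hxb⟩ := key _ (micros_state hq hi n) h.2
  have ha : e.Reach i n a := ⟨h1, h2.head hab⟩
  have hinv := ha.inv hq hi
  rcases hab.opens_or_stays hinv with ⟨y, hy⟩ | hs
  swap
  · rw [hs.sent] at hxb; exact absurd hxb hxa
  have hxy : x = y := by
    rw [hy.sent] at hxb
    exact (Finset.mem_insert.1 hxb).resolve_right hxa
  subst hxy
  refine ⟨a.1.dag, h1.dag_mono, ha.after.dag_mono, hinv.closed, hy.vertex, hy.quorum, ?_⟩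
  have h0 : 1 ≤ x.round := by have := hy.round_eq; omega
  rcases hy.reason with hr | hr | ⟨hr, hm⟩
  · exact .inl hr
  · right; left
    -- The quorum contains an honest vertex. It is not one of `i`, whose earlier vertices have
    -- smaller rounds, so by authenticity it was broadcast before this event.
    have := card_honest_layer he hi ha.after.dag_mono h0 hr
    obtain ⟨z, hz⟩ := Finset.card_pos.1 (by omega :
      0 < ((layer a.1.dag x.round).filter fun x => e.Honest x.source).card)
    obtain ⟨hz, hzs⟩ := Finset.mem_filter.1 hz
    obtain ⟨hz, hzr⟩ := mem_layer.1 hz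
    refine ⟨z, hz, hzr, hzs, ?_⟩
    rcases ha.mem_sent_of_honest he hi hz (by omega) hzs with h' | h'
    · have := hy.fresh z h'
      omega
    · exact exists_rbcast_of_mem_sent hzs h'
  · cases hw : a.1.wait
    · right; right; left
      rw [← hr]
      exact (ha.timer hq hi).2 hw
    · exact .inr (.inr (.inr ⟨a.1, rfl, hr, hw, hm⟩))

end Execution

end

section

variable {P : Type u} {B : Type v} [Fintype P] {c : Setup P B} {i j : P} {now : ℝ} {ev : Event P B}

/-! ### Invariants of delivery and of the queue -/

theorem Micro.delivered {a b : State P B × Finset (Vertex P B)} (hab : Micro c i now ev a b)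
    (ha : Inv c i a) (h : Delivered a.1) : Delivered b.1 := by
  have hd := hab.dag_mono
  cases hab with
  | order s p x => exact tryOrdering_delivered c h x
  | _ => exact h.mono ha.closed hd rfl rfl rfl

/-- The fate of the `q`-th block of a party: it is in the queue until round `q` is entered. -/
def Queued (q : ℕ) (b : B) (s : State P B) : Prop :=
  (q ≤ entered s ∧ ∃ x ∈ s.sent, x.round = q ∧ x.block = b) ∨
    (entered s < q ∧ s.queue[q - entered s - 1]? = some b)

/-- Opening a round removes the head of the queue and raises `entered` by one, so the position
computed from `q` keeps pointing at the same block until it is used. -/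
theorem Micro.queued {a b : State P B × Finset (Vertex P B)} (hab : Micro c i now ev a b)
    (ha : Inv c i a) {q : ℕ} {blk : B} (h : Queued q blk a.1) : Queued q blk b.1 := by
  rcases hab.opens_or_stays ha with ⟨x, hx⟩ | hx
  · have he : entered b.1 = entered a.1 + 1 := by
      rw [← hx.round_eq, entered, hx.started, if_pos rfl, hx.round]
    unfold Queued
    rw [he, hx.sent]
    obtain ⟨h1, y, hy, h2⟩ | ⟨h1, h2⟩ := h
    · exact .inl ⟨by omega, y, Finset.mem_insert_of_mem hy, h2⟩
    · rw [hx.queue] at h2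
      rcases (Nat.succ_le_of_lt h1).eq_or_lt with h3 | h3
      · refine .inl ⟨h3.ge, x, Finset.mem_insert_self _ _, by rw [hx.round_eq, ← h3], ?_⟩
        rw [show q - entered a.1 - 1 = 0 by omega] at h2
        simpa using h2
      · refine .inr ⟨h3, ?_⟩
        rwa [show q - entered a.1 - 1 = (q - (entered a.1 + 1) - 1) + 1 by omega,
          List.getElem?_cons_succ] at h2
  · have he : entered b.1 = entered a.1 := by rw [entered, hx.started, hx.round, entered]
    unfold Queued
    rw [he, hx.sent]
    refine h.imp_right fun ⟨h1, h2⟩ => ⟨h1, ?_⟩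
    obtain ⟨t, ht⟩ := hx.queue
    rw [← ht, List.getElem?_append_left (List.getElem?_eq_some_iff.1 h2).1, h2]

theorem wait_beginRound {r : ℕ} {s : State P B} : (beginRound c i now r s).wait = true := by
  rcases hq : s.queue with _ | ⟨b, q⟩
  · unfold beginRound; rw [hq]
  · rw [beginRound_cons hq, (tryOrdering_sameCore c _ _).wait]; rfl

theorem round_beginRound {r : ℕ} {s : State P B} : (beginRound c i now r s).round = r := by
  rcases hq : s.queue with _ | ⟨b, q⟩
  · unfold beginRound; rw [hq]
  · rw [beginRound_cons hq, (tryOrdering_sameCore c _ _).round]; rfl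

theorem quorum_of_wait_tryAdvance {s : State P B} (h : (tryAdvance c i now s).wait = false) :
    ¬ 2 * c.f + 1 ≤ (layer (tryAdvance c i now s).dag (tryAdvance c i now s).round).card := by
  unfold tryAdvance at h ⊢
  split_ifs at h ⊢ with hl
  · rw [wait_beginRound] at h; cases h
  · exact hl

namespace Execution

variable {e : Execution c}

theorem delivered_state (hq : e.NeverStarved) (hi : e.Honest i) (n : ℕ) :
    Delivered (e.state n i) := by
  refine reach_induction (Q := fun _ a => Delivered a.1) hq hi ?_ ?_ ?_ (reach_state hq hi n)
  · constructor <;> simp [initialState]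
  · exact fun n a b ha _ hab h => hab.delivered (ha.inv hq hi) h
  · exact fun n s h => h

/-- Leader vertices with enough votes are committed. -/
theorem Reach.commits (he : e.Regular) (hi : e.Honest i) {n : ℕ}
    {a : State P B × Finset (Vertex P B)} (ha : e.Reach i n a) :
    ∀ x ∈ a.1.dag, x ∉ a.2 → ∀ l w, Decides c x l w →
      c.f + 1 ≤ (x.strongEdges.filter fun y => StrongPath a.1.dag y l).card →
      l ∈ a.1.committed := by
  have hq := he.neverStarved
  refine reach_induction (Q := fun _ a => ∀ x ∈ a.1.dag, x ∉ a.2 → ∀ l w, Decides c x l w →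
      c.f + 1 ≤ (x.strongEdges.filter fun y => StrongPath a.1.dag y l).card →
      l ∈ a.1.committed) hq hi ?_ ?_ (fun _ _ h => h) ha
  · intro x hx _ l w hd
    have := c.genesis_round x hx
    obtain ⟨hw, hd | hd⟩ := hd <;> omega
  · intro n a b ha hb hab h
    have hinv := ha.inv hq hi
    have key : ∀ x ∈ a.1.dag, x ∉ a.2 → ∀ l w, Decides c x l w →
        c.f + 1 ≤ (x.strongEdges.filter fun y => StrongPath b.1.dag y l).card →
        l ∈ b.1.committed := by
      intro x hx hxp l w hd hv
      -- The votes are strong edges of a vertex of the closed old DAG, so their paths to `l` existed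
      -- before the step.
      refine hab.committed_mono (h x hx hxp l w hd (hv.trans (Finset.card_le_card ?_)))
      intro y hy
      obtain ⟨hy, hp⟩ := Finset.mem_filter.1 hy
      exact Finset.mem_filter.2 ⟨hy, (hp.restrict hinv.closed
        (hinv.closed x hx (strongEdges_subset_edges x hy))).2⟩
    have hfresh : ∀ y, b.1.dag = insert y a.1.dag → b.2 = insert y a.2 →
        ∀ x ∈ b.1.dag, x ∉ b.2 → x ∈ a.1.dag ∧ x ∉ a.2 := by
      intro y h1 h2 x hx hxp
      rw [h2, Finset.mem_insert, not_or] at hxp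
      rw [h1] at hx
      exact ⟨(Finset.mem_insert.1 hx).resolve_left hxp.1, hxp.2⟩
    intro x hx hxp l w hd hv
    cases hab with
    | order s p z hz =>
      have hcore := tryOrdering_sameCore c s z
      have hx' : x ∈ s.dag := hcore.dag ▸ hx
      by_cases hxz : x = z
      · subst hxz
        dsimp only at hv
        rw [hcore.dag] at hv
        -- A single vote already shows that `l` is in the DAG; then `dag_unique` makes the leader
        -- lookup return `l`.
        obtain ⟨y, hy⟩ := Finset.card_pos.1 (by omega : 0 <
          (x.strongEdges.filter fun y => StrongPath s.dag y l).card)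
        obtain ⟨hy, hp⟩ := Finset.mem_filter.1 hy
        have hl := (hp.restrict hinv.closed
          (hinv.closed x hx' (strongEdges_subset_edges x hy))).1
        have hl1 : 1 ≤ l.round := by obtain ⟨hw, hd | hd⟩ := hd <;> omega
        have hsub := ha.after.dag_mono
        exact mem_committed_tryOrdering c hd hl
          (fun y hy hr hs => dag_unique he hi hi (hsub hl) (hsub hy) hl1 hr hs) hv
      · refine key x hx' (fun h => hxp (Finset.mem_erase.2 ⟨hxz, h⟩)) l w hd hv
    | add s y =>
      obtain ⟨h1, h2⟩ := hfresh y rfl rfl x hx hxp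
      exact key x h1 h2 l w hd hv
    | start s p b q =>
      obtain ⟨h1, h2⟩ := hfresh _ rfl rfl x hx hxp
      exact key x h1 h2 l w hd hv
    | jump s p r b q =>
      obtain ⟨h1, h2⟩ := hfresh _ rfl rfl x hx hxp
      exact key x h1 h2 l w hd hv
    | advance s p b q =>
      obtain ⟨h1, h2⟩ := hfresh _ rfl rfl x hx hxp
      exact key x h1 h2 l w hd hv
    | _ => exact key x hx hxp l w hd hv

/-- The `q`-th block of an honest party becomes the block of its vertex of round `q`. -/
theorem block_eq_of_aBcast (hq : e.NeverStarved) (hi : e.Honest i) {n m k : ℕ} {b : B}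
    {x : Vertex P B} (hev : e.event n = .aBcast i b k) (hx : e.RBcast m i x)
    (hr : x.round = k) : x.block = b := by
  have hstep := e.state_step n i hi (by rw [hev]; rfl)
  rw [hev] at hstep
  obtain ⟨hk, hs⟩ := hstep
  have hinv := inv_state hq hi n
  have hseq := hinv.seq
  dsimp only at hseq
  have h0 : Queued k b (e.state (n + 1) i) := by
    rw [hs]
    refine .inr ⟨?_, ?_⟩
    · simp only [entered] at hseq ⊢; omega
    · rw [show k - entered _ - 1 = (e.state n i).queue.length by
        simp only [entered] at hseq ⊢; omega]
      simp
  have h1 : ∀ l, n + 1 ≤ l → Queued k b (e.state l i) := by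
    intro l hl
    induction l, hl using Nat.le_induction with
    | base => exact h0
    | succ l _ ih =>
      have hinv := inv_state hq hi l
      have hch := micros_state hq hi l
      have key : ∀ a, Micros c i (e.time l) (e.event l) (e.state l i, ∅) a → Queued k b a.1 := by
        intro a ha
        induction ha with
        | refl => exact ih
        | tail h hab ih => exact hab.queued (hinv.micros h) ih
      exact key _ hch
  have hmax := sent_mono hq hi (le_max_left (m + 1) (n + 1)) hx.2
  have hinv' := inv_state hq hi (max (m + 1) (n + 1))
  obtain ⟨-, y, hy, hyr, hyb⟩ | ⟨h2, -⟩ := h1 _ (le_max_right (m + 1) (n + 1))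
  · rw [hinv'.sent_unique x hmax y hy (by omega), hyb]
  · have h3 := hinv'.sent x hmax
    have hst := hinv'.started_of_mem h3.2.2.2 h3.2.1
    dsimp only at hst h3
    simp only [entered, hst, if_true] at h2
    omega

/-! ### Rounds end -/

/-- An expired timer satisfies `MayAdvance`, so the timeout and each later legal delivery end in
`tryAdvance`. With a quorum this would open a round and set `wait` again. -/
theorem quorum_of_wait (hi : e.Honest i) (n : ℕ) (h : (e.state n i).wait = false) :
    ¬ 2 * c.f + 1 ≤ (layer (e.state n i).dag (e.state n i).round).card := by
  induction n with
  | zero => rw [e.state_zero i hi] at h; simp [initialState] at h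
  | succ n ih =>
    by_cases hp : (e.event n).party = i
    · have hstep := e.state_step n i hi hp
      cases hev : e.event n with
      | aBcast j b k =>
        rw [hev] at hstep
        obtain ⟨-, hs⟩ := hstep
        rw [hs] at h ⊢
        exact ih h
      | start j =>
        rw [hev] at hstep
        obtain ⟨-, hs⟩ := hstep
        rw [hs, wait_beginRound] at h
        cases h
      | timeout j =>
        rw [hev] at hstep
        obtain ⟨t₀, -, -, hs⟩ := hstep
        rw [hs] at h ⊢
        exact quorum_of_wait_tryAdvance h
      | deliver j x r p =>
        rw [hev] at hstep
        obtain ⟨-, ⟨-, hs⟩ | ⟨-, s₁, -, hs⟩⟩ := hstep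
        · rw [hs] at h ⊢
          exact ih h
        · rw [hs] at h ⊢
          split_ifs at h ⊢ with hm
          · exact quorum_of_wait_tryAdvance h
          · exact absurd (.inl h) hm
    · rw [e.state_idle n i hi hp] at h ⊢
      exact ih h

/-- With a quorum in its current round, a party leaves the round when its timer expires. -/
theorem time_le_of_quorum (hq : e.NeverStarved) (hi : e.Honest i) {m n r : ℕ}
    (hr : (e.state n i).round = r) (hl : 2 * c.f + 1 ≤ (layer (e.state n i).dag r).card)
    (hm : e.Enters m i r) (hmn : m < n) : e.time n ≤ e.time m + c.timeout := by
  subst hr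
  have hw : (e.state n i).wait = true := by
    by_contra hw
    exact quorum_of_wait hi n (by simpa using hw) hl
  have ht := (inv_state hq hi n).timer (hm.state hq hi hmn).1 hw
  obtain ⟨t₀, ht⟩ := Option.ne_none_iff_exists'.1 ht
  obtain ⟨k, -, hk, hke⟩ := ((reach_state hq hi n).timer hq hi).1 t₀ ht
  rw [hm.unique hq hi hke, hk]
  exact e.timer_expires n i t₀ hi ht

/-! ### Handling of deliveries -/

variable (e) in
/-- In the `m`-th event party `j` handles the delivery of a legal vertex; `s` is its state when the
buffer has been flushed. -/
structure Handled (j : P) (m : ℕ) (s : State P B) : Prop where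
  reach : e.Reach j m (s, ∅)
  flushed : ∀ x ∈ s.buffer, ¬ Ready s x
  next : e.state (m + 1) j = if MayAdvance c s then tryAdvance c j (e.time m) s else s
  received : ∀ k ≤ m, ∀ x, e.event k = .deliver j x x.round x.source → WellFormed c x →
    x ∈ s.dag ∪ s.buffer

theorem exists_handled (hq : e.NeverStarved) (hj : e.Honest j) {m : ℕ} {x : Vertex P B}
    (hev : e.event m = .deliver j x x.round x.source) (hx : WellFormed c x) :
    ∃ s, e.Handled j m s := by
  have key : ∀ k (y : Vertex P B), e.event k = .deliver j y y.round y.source →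
      WellFormed c y → ∃ s, Relation.ReflTransGen (AddStep c j (e.time k))
        { e.state k j with buffer := insert y (e.state k j).buffer } s ∧ e.Reach j k (s, ∅) ∧
        (∀ x ∈ s.buffer, ¬ Ready s x) ∧
        (e.state (k + 1) j = if MayAdvance c s then tryAdvance c j (e.time k) s else s) ∧
        y ∈ s.dag ∪ s.buffer := by
    intro k y hev hy
    have hstep := e.state_step k j hj (by rw [hev]; rfl)
    have hlegal : Legal c y y.round y.source := ⟨rfl, rfl, hy⟩
    rw [hev] at hstep
    obtain ⟨hs, ⟨h, -⟩ | ⟨-, s, hf, hnext⟩⟩ := hstep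
    · exact absurd hlegal h
    have hst : (e.state (k + 1) j).starved = false := hq _ _ hj
    have hsst : s.starved = false := by
      by_contra h
      have h : s.starved = true := by simpa using h
      rw [hnext] at hst
      split_ifs at hst
      · rw [starved_tryAdvance h] at hst; cases hst
      · rw [h] at hst; cases hst
    have hfl := micros_flush (ev := e.event k) hf.1 hsst
    refine ⟨s, hf.1, ⟨.head (.receive _ _ y _ _ hev hlegal hs) hfl.1, ?_⟩, hf.2, hnext, ?_⟩
    · rw [hnext] at hst ⊢
      split_ifs at hst ⊢ with hm
      · exact micros_tryAdvance (hfl.2.trans hs) hm hst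
      · exact .refl
    · exact hfl.1.known_mono (by simp)
  obtain ⟨s, -, hr, hf, hn, hxs⟩ := key m x hev hx
  refine ⟨s, hr, hf, hn, fun k hk y hky hy => ?_⟩
  rcases hk.eq_or_lt with rfl | hk
  · rw [hev] at hky
    injection hky with _ h
    exact h ▸ hxs
  · obtain ⟨s', -, hr', -, -, hys⟩ := key k y hky hy
    exact hr.before.known_mono (known_mono hq hj hk (hr'.after.known_mono hys))

/-- A closed set of vertices all of which are delivered is in the DAG once the last of these
deliveries has been handled. -/
theorem exists_handled_of_closed (hq : e.NeverStarved) (hj : e.Honest j)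
    {d : Finset (Vertex P B)} (hc : Closed d) (hd : ∀ x ∈ d, x ∈ c.genesis ∨ WellFormed c x)
    {Q : ℕ → Prop} (hdel : ∀ x ∈ d, 1 ≤ x.round →
      ∃ m, Q m ∧ e.event m = .deliver j x x.round x.source)
    (hne : ∃ x ∈ d, 1 ≤ x.round) :
    ∃ m s, Q m ∧ e.Handled j m s ∧ d ⊆ s.dag := by
  choose! g hg using hdel
  -- The event sought is the last of the chosen deliveries.
  obtain ⟨x, hx, hmax⟩ := (d.filter fun x => 1 ≤ x.round).exists_max_image g
    (by obtain ⟨x, hx, h1⟩ := hne; exact ⟨x, Finset.mem_filter.2 ⟨hx, h1⟩⟩)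
  obtain ⟨hx, hx1⟩ := Finset.mem_filter.1 hx
  have hwf : ∀ x ∈ d, 1 ≤ x.round → WellFormed c x := fun x hx h1 =>
    (hd x hx).resolve_left fun h => by have := c.genesis_round x h; omega
  obtain ⟨s, hs⟩ := exists_handled hq hj (hg x hx hx1).2 (hwf x hx hx1)
  refine ⟨g x, s, (hg x hx hx1).1, hs, ?_⟩
  -- By induction on the round all references of `y` are in the DAG. A copy of `y` left in the
  -- buffer would be ready, which the flush excludes.
  have key : ∀ r, ∀ y ∈ d, y.round = r → y ∈ s.dag := by
    intro r
    induction r using Nat.strong_induction_on with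
    | _ r ih =>
      intro y hy hyr
      rcases hd y hy with h | h
      · exact (hs.reach.inv hq hj).genesis h
      · have hy1 := h.one_le_round
        have hgy := hmax y (Finset.mem_filter.2 ⟨hy, hy1⟩)
        rcases Finset.mem_union.1 (hs.received _ hgy y (hg y hy hy1).2 h) with h' | h'
        · exact h'
        · refine absurd (fun z hz => ?_) (hs.flushed y h')
          refine ih z.round ?_ z (hc y hy hz) rfl
          rcases Finset.mem_union.1 hz with hz | hz
          · have := h.2.1 z hz; omega
          · have := h.2.2 z hz; omega
  exact fun y hy => key _ y hy rfl

theorem Handled.round_le {m : ℕ} {s : State P B}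
    (h : e.Handled j m s) : s.round ≤ (e.state (m + 1) j).round := by
  rw [h.next]
  split_ifs
  · unfold tryAdvance
    split_ifs
    · rw [round_beginRound]; omega
    · exact le_rfl
  · exact le_rfl

theorem Handled.round_eq {m : ℕ} {s : State P B} (h : e.Handled j m s) (hm : MayAdvance c s)
    (hl : 2 * c.f + 1 ≤ (layer s.dag s.round).card) :
    (e.state (m + 1) j).round = s.round + 1 := by
  rw [h.next, if_pos hm, tryAdvance, if_pos hl, round_beginRound]

theorem Handled.dag_subset {m : ℕ} {s : State P B} (h : e.Handled j m s) :
    s.dag ⊆ (e.state (m + 1) j).dag := h.reach.after.dag_mono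

/-! ### The union of the honest DAGs -/

variable (e) in
/-- All vertices in the local DAGs of honest parties just before the `n`-th event. -/
noncomputable def allDags (n : ℕ) : Finset (Vertex P B) :=
  (Finset.univ.filter fun p => e.Honest p).biUnion fun p => (e.state n p).dag

theorem mem_allDags {n : ℕ} {x : Vertex P B} :
    x ∈ e.allDags n ↔ ∃ p, e.Honest p ∧ x ∈ (e.state n p).dag := by
  simp [allDags]

theorem dag_subset_allDags (hi : e.Honest i) (n : ℕ) : (e.state n i).dag ⊆ e.allDags n :=
  fun _ hx => mem_allDags.2 ⟨i, hi, hx⟩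

/-- `Q` carries a deadline for the deliveries; it is trivial when only eventual delivery matters. -/
theorem exists_handled_of_allDags (hq : e.NeverStarved) (hj : e.Honest j) {n : ℕ} {Q : ℕ → Prop}
    (hdel : ∀ i, e.Honest i → ∀ x ∈ (e.state n i).dag, 1 ≤ x.round →
      ∃ m, Q m ∧ e.event m = .deliver j x x.round x.source)
    (hne : ∃ i, e.Honest i ∧ (e.state n i).started = true) :
    ∃ m s, Q m ∧ e.Handled j m s ∧ e.allDags n ⊆ s.dag := by
  refine exists_handled_of_closed hq hj (d := e.allDags n) ?_ ?_ ?_ ?_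
  · intro x hx
    obtain ⟨i, hi, hx⟩ := mem_allDags.1 hx
    exact ((inv_state hq hi n).closed x hx).trans (dag_subset_allDags hi n)
  · intro x hx
    obtain ⟨i, hi, hx⟩ := mem_allDags.1 hx
    exact (inv_state hq hi n).wf x hx
  · intro x hx
    obtain ⟨i, hi, hx⟩ := mem_allDags.1 hx
    exact hdel i hi x hx
  · obtain ⟨i, hi, hs⟩ := hne
    have hinv := inv_state hq hi n
    obtain ⟨x, hx, hr⟩ := hinv.sent_exists hs 1 le_rfl hinv.one_le_round
    exact ⟨x, mem_allDags.2 ⟨i, hi, (hinv.sent x hx).2.2.2⟩, hr.ge⟩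

theorem exists_allDags_subset (he : e.Regular) (hj : e.Honest j) {n : ℕ}
    (hne : ∃ i, e.Honest i ∧ (e.state n i).started = true) :
    ∃ m, e.allDags n ⊆ (e.state m j).dag := by
  obtain ⟨m, s, -, hs, hsub⟩ := exists_handled_of_allDags (Q := fun _ => True) he.neverStarved hj
    (fun i hi x hx h1 => by
      obtain ⟨m, hm⟩ := exists_deliver_of_mem_dag he hi hx h1
      obtain ⟨m', hm'⟩ := he.broadcast.agreement m i j x _ _ hi hj hm
      exact ⟨m', trivial, hm'⟩) hne
  exact ⟨m + 1, hsub.trans hs.dag_subset⟩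

theorem card_layer_of_honest {d : Finset (Vertex P B)} {r : ℕ}
    (h : ∀ p, e.Honest p → ∃ x ∈ d, x.round = r ∧ x.source = p) :
    2 * c.f + 1 ≤ (layer d r).card := by
  refine e.card_honest.trans ?_
  refine le_trans (Finset.card_le_card ?_)
    (Finset.card_image_le (s := layer d r) (f := Vertex.source))
  intro p hp
  obtain ⟨x, hx, hr, hs⟩ := h p (Finset.mem_filter.1 hp).2
  exact Finset.mem_image.2 ⟨x, mem_layer.2 ⟨hx, hr⟩, hs⟩

/-- The vertices with which the honest parties have entered round `r`. -/
theorem card_layer_allDags (hq : e.NeverStarved) {n r : ℕ}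
    (h : ∀ p, e.Honest p → ∃ m < n, e.Enters m p r) :
    2 * c.f + 1 ≤ (layer (e.allDags n) r).card := by
  refine card_layer_of_honest (e := e) fun p hp => ?_
  obtain ⟨m, hm, x, hx, hr⟩ := h p hp
  have := (inv_state hq hp n).sent x (sent_mono hq hp hm hx.2)
  exact ⟨x, mem_allDags.2 ⟨p, hp, this.2.2.2⟩, hr, this.1⟩

theorem exists_honest (e : Execution c) : ∃ p, e.Honest p := by
  have := e.card_honest
  obtain ⟨p, hp⟩ := Finset.card_pos.1 (by omega : 0 < (Finset.univ.filter fun p => e.Honest p).card)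
  exact ⟨p, (Finset.mem_filter.1 hp).2⟩

/-- Facts about single honest parties that persist hold for all of them at some time. -/
theorem exists_forall_honest {Q : P → ℕ → Prop} (hmono : ∀ p m n, m ≤ n → Q p m → Q p n)
    (h : ∀ p, e.Honest p → ∃ n, Q p n) : ∃ n, ∀ p, e.Honest p → Q p n := by
  choose! g hg using h
  exact ⟨Finset.univ.sup g, fun p hp =>
    hmono p _ _ (Finset.le_sup (f := g) (Finset.mem_univ p)) (hg p hp)⟩

/-- Every honest party enters every round. -/
theorem exists_enters_round (he : e.Regular) {r : ℕ} (hr : 1 ≤ r) :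
    ∀ i, e.Honest i → ∃ n, e.Enters n i r := by
  have hq := he.neverStarved
  induction r, hr using Nat.le_induction with
  | base =>
    intro i hi
    obtain ⟨n, hn⟩ := e.starts i hi
    have hstep := e.state_step n i hi (by rw [hn]; rfl)
    rw [hn] at hstep
    obtain ⟨-, hs⟩ := hstep
    have hst : (e.state (n + 1) i).started = true := by rw [hs, started_beginRound]
    obtain ⟨m, -, hm⟩ := exists_enters hq hi hst le_rfl (inv_state hq hi _).one_le_round
    exact ⟨m, hm⟩
  | succ r hr ih =>
    intro i hi
    by_contra hno
    push Not at hno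
    obtain ⟨N, hN⟩ := exists_forall_honest (e := e) (Q := fun p n => ∃ m < n, e.Enters m p r)
      (fun p m n hmn ⟨k, hk, h⟩ => ⟨k, by omega, h⟩)
      (fun p hp => by obtain ⟨m, hm⟩ := ih p hp; exact ⟨m + 1, m, by omega, hm⟩)
    obtain ⟨k, hkN, hk⟩ := hN i hi
    obtain ⟨M, hM⟩ := exists_allDags_subset he hi ⟨i, hi, (hk.state hq hi hkN).1⟩
    -- A party stuck in round `r` with the quorum of honest vertices has a running timer, which
    -- would bound the times of all later events.
    have hlt : ∀ n, max N M ≤ n → e.time n ≤ e.time k + c.timeout := by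
      intro n hn
      have hkn : k < n := by have := le_max_left N M; omega
      have hstate := hk.state hq hi hkn
      refine time_le_of_quorum hq hi ?_ ?_ hk hkn
      · by_contra hne
        obtain ⟨m, -, hm⟩ := exists_enters hq hi (r := r + 1) hstate.1 (by omega) (by omega)
        exact hno m hm
      · refine (card_layer_allDags hq hN).trans (Finset.card_le_card (layer_mono ?_ r))
        exact hM.trans (dag_mono hq hi ((le_max_right _ _).trans hn))
    obtain ⟨n, hn⟩ := ((Filter.tendsto_atTop.1 e.time_unbounded (e.time k + c.timeout + 1)).and
      (Filter.eventually_ge_atTop (max N M))).exists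
    have := hlt n hn.2
    linarith [hn.1]

end Execution

end

section

variable {P : Type u} {B : Type v} [Fintype P] {c : Setup P B} {i j : P}

namespace Execution

variable {e : Execution c}

/-! ### Synchrony -/

/-- The last event up to a given time. -/
theorem exists_last (e : Execution c) {t : ℝ} (h : ∃ n, e.time n ≤ t) :
    ∃ N, e.time N ≤ t ∧ ∀ m, e.time m ≤ t → m ≤ N := by
  obtain ⟨M, hM⟩ := (Filter.tendsto_atTop.1 e.time_unbounded (t + 1)).exists_forall_of_atTop
  have hb : ∀ m, e.time m ≤ t → m ≤ M := by
    intro m hm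
    by_contra hlt
    have := hM m (by omega)
    linarith
  obtain ⟨n, hn⟩ := h
  exact ⟨Nat.findGreatest (fun m => e.time m ≤ t) M,
    Nat.findGreatest_spec (P := fun m => e.time m ≤ t) (hb n hn) hn,
    fun m hm => Nat.le_findGreatest (hb m hm) hm⟩

variable (e) in
/-- From time `T` on, whatever honest parties broadcast or deliver reaches all honest parties
within time `Δ`. -/
structure Synchronous (Δ T : ℝ) : Prop where
  regular : e.Regular
  nonneg : 0 ≤ Δ
  deliver : ∀ n i j x, e.Honest i → e.Honest j → T ≤ e.time n → x ∈ (e.state (n + 1) i).dag →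
    1 ≤ x.round → ∃ m, e.time m ≤ e.time n + Δ ∧ e.event m = .deliver j x x.round x.source

/-- Each vertex of the DAG stems from a broadcast or delivery no later than event `n`. If that lies
before `GST`, then `T` is the deadline; otherwise the bound `Δ` applies. -/
theorem synchronous_of_caughtUp {Δ GST T : ℝ} (hΔ : 0 ≤ Δ) (he : e.Regular)
    (htimely : e.TimelyBroadcast Δ GST) (hT : e.CaughtUp GST T) : e.Synchronous Δ T := by
  refine ⟨he, hΔ, fun n i j x hi hj hn hx h1 => ?_⟩
  have hr : e.Reach i n (e.state (n + 1) i, ∅) := ⟨micros_state he.neverStarved hi n, .refl⟩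
  rcases (hr.known he.neverStarved hi).2 x hx h1 with h | ⟨k, hk, hev⟩
  · obtain ⟨k, hk, hb⟩ := exists_rbcast_of_mem_sent hi h
    have hkn : e.time k ≤ e.time n := e.time_mono (by omega)
    rw [((inv_state he.neverStarved hi (n + 1)).sent x h).1]
    rcases lt_or_ge (e.time k) GST with hlt | hge
    · obtain ⟨m, hm, hmt⟩ := hT.of_bcast k i j x hi hj hlt hb
      exact ⟨m, by linarith, hm⟩
    · obtain ⟨m, hm, hmt⟩ := htimely.of_bcast k i j x hi hj hge hb
      exact ⟨m, by linarith, hm⟩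
  · have hkn : e.time k ≤ e.time n := e.time_mono hk
    rcases lt_or_ge (e.time k) GST with hlt | hge
    · obtain ⟨m, hm, hmt⟩ := hT.of_deliver k i j x _ _ hi hj hlt hev
      exact ⟨m, by linarith, hm⟩
    · obtain ⟨m, hm, hmt⟩ := htimely.of_deliver k i j x _ _ hi hj hge hev
      exact ⟨m, by linarith, hm⟩

theorem Synchronous.exists_handled {Δ T : ℝ} (hS : e.Synchronous Δ T) {n r : ℕ} (hi : e.Honest i)
    (hj : e.Honest j) (hn : T ≤ e.time n) (hs : ∃ m ≤ n, e.Enters m i r) :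
    ∃ m s, e.time m ≤ e.time n + Δ ∧ e.Handled j m s ∧ e.allDags (n + 1) ⊆ s.dag := by
  obtain ⟨k, hk, hs⟩ := hs
  exact exists_handled_of_allDags hS.regular.neverStarved hj
    (fun i hi x hx h1 => hS.deliver n i j x hi hj hn hx h1)
    ⟨i, hi, (hs.state hS.regular.neverStarved hi (by omega : k < n + 1)).1⟩

theorem RBcast.mem_allDags (hq : e.NeverStarved) (hi : e.Honest i) {m n : ℕ} {x : Vertex P B}
    (h : e.RBcast m i x) (hmn : m < n) : x ∈ e.allDags n :=
  dag_subset_allDags hi n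
    ((inv_state hq hi n).sent x (sent_mono hq hi hmn h.2)).2.2.2

/-- Past rounds have a quorum in the DAG of the parties that have entered a later one. -/
theorem Enters.quorum (he : e.Regular) (hi : e.Honest i) {m n r : ℕ} (h : e.Enters m i (r + 1))
    (hmn : m < n) : 2 * c.f + 1 ≤ (layer (e.allDags n) r).card := by
  obtain ⟨x, hx, hr⟩ := h
  obtain ⟨d, hd⟩ := hx.origin he hi
  have := hd.quorum
  rw [hr, Nat.add_sub_cancel] at this
  exact this.trans (Finset.card_le_card (layer_mono
    ((hd.ge.trans (dag_mono he.neverStarved hi hmn)).trans (dag_subset_allDags hi n)) r))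

theorem Handled.le_round (hq : e.NeverStarved) (hj : e.Honest j) {m r : ℕ} {s : State P B}
    (h : e.Handled j m s) (hl : 2 * c.f + 1 ≤ (layer s.dag r).card) : r ≤ s.round := by
  have := (h.reach.inv hq hj).quorum r hl
  simpa using this

/-- Event `k` is not assumed to precede event `m`. But the vertex created at `k` is in the DAG of
its own creator, and by authenticity it can be there only after it has been sent. -/
theorem Handled.le_round_of_enters (he : e.Regular) (hj : e.Honest j) {m n k r : ℕ}
    {s : State P B} (h : e.Handled j m s) (hs : e.allDags n ⊆ s.dag) (hk : k < n)
    (hkr : e.Enters k j r) : r ≤ s.round := by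
  have hq := he.neverStarved
  obtain ⟨x, hx, rfl⟩ := hkr
  have hinv := h.reach.inv hq hj
  have hsent := (inv_state hq hj n).sent x (sent_mono hq hj hk hx.2)
  refine (hinv.sent x ?_).2.2.1
  rcases h.reach.mem_sent_of_honest he hj (hs (hx.mem_allDags hq hj hk)) hsent.2.1
    (hsent.1 ▸ hj) with h' | h'
  · exact h'
  · rw [hsent.1] at h'
    exact h.reach.before.sent_mono h'

theorem exists_first_enters (he : e.Regular) {r : ℕ} (hr : 1 ≤ r) :
    ∃ n p, e.Honest p ∧ e.Enters n p r ∧ ∀ m q, e.Honest q → e.Enters m q r → n ≤ m := by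
  have h : ∃ n, ∃ p, e.Honest p ∧ e.Enters n p r := by
    obtain ⟨p, hp⟩ := e.exists_honest
    obtain ⟨n, hn⟩ := exists_enters_round he hr p hp
    exact ⟨n, p, hp, hn⟩
  obtain ⟨p, hp, hn⟩ := Nat.find_spec h
  exact ⟨Nat.find h, p, hp, hn, fun m q hq hm => Nat.find_min' h ⟨q, hq, hm⟩⟩

/-- If some honest party sees enough votes for a leader vertex, all honest parties commit it. -/
theorem exists_commit_of_votes (he : e.Regular) (hj : e.Honest j) {n w : ℕ} {x l : Vertex P B}
    (hx : x ∈ (e.state n j).dag) (hd : Decides c x l w)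
    (hv : c.f + 1 ≤ (x.strongEdges.filter fun y => StrongPath (e.state n j).dag y l).card)
    (hi : e.Honest i) : ∃ m, l ∈ (e.state m i).committed := by
  have hq := he.neverStarved
  have hx1 : 1 ≤ x.round := by obtain ⟨hw, hd | hd⟩ := hd <;> omega
  obtain ⟨m, hm⟩ := exists_allDags_subset he hi (n := n)
    ⟨j, hj, (inv_state hq hj n).started_of_mem hx hx1⟩
  have hsub := (dag_subset_allDags hj n).trans hm
  refine ⟨m, (reach_state hq hi m).commits he hi x (hsub hx) (by simp) l w hd (hv.trans ?_)⟩
  exact Finset.card_le_card (Finset.monotone_filter_right _ fun y _ h => h.mono hsub)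

/-- As the timer is still running, the advance rests on votes. The strong edges of `x` are the whole
previous layer, hence contain all `2f + 1` votes, and `f + 1` suffice for a commit. -/
theorem exists_commit_of_hasVotes (he : e.Regular) (hj : e.Honest j) {n w : ℕ} (hw : 1 ≤ w)
    {x : Vertex P B} {d : Finset (Vertex P B)} (ho : Origin e n j x d)
    (hxs : x ∈ (e.state (n + 1) j).dag) (hr : x.round = 4 * w - 1)
    {s : State P B} (hd : s.dag = d) (hs : s.round = x.round - 1) (hwait : s.wait = true)
    (hm : MayAdvance c s) : ∃ l, l.round = 4 * w - 3 ∧ l.source = c.leader₁ w ∧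
      ∀ i, e.Honest i → ∃ m, l ∈ (e.state m i).committed := by
  subst hd
  have hv : HasVotes c s (firstLeader c s.dag (wave s.round)) := by
    rcases hm with h | h | h | h | h
    · rw [hwait] at h; cases h
    · omega
    · exact h.2
    · omega
    · omega
  obtain ⟨l, hl, U, hU, hUc, hUp⟩ := hv
  rw [show wave s.round = w by unfold wave; omega] at hl
  obtain ⟨-, -, hlr, hls⟩ := firstLeader_mem c hl
  refine ⟨l, hlr, hls, fun i hi => ?_⟩
  refine exists_commit_of_votes he hj hxs (w := w) ⟨hw, .inl ⟨hr, hlr, hls⟩⟩ ?_ hi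
  have : U ⊆ x.strongEdges.filter fun y => StrongPath (e.state (n + 1) j).dag y l := by
    intro y hy
    rw [ho.strongEdges, ← hs]
    exact Finset.mem_filter.2 ⟨hU hy, (hUp y hy).mono ho.ge⟩
  have := Finset.card_le_card this
  omega

/-! ### A wave with honest leaders -/

section wave

variable {Δ T : ℝ} {w : ℕ}

theorem RBcast.mem_dag (hq : e.NeverStarved) (hi : e.Honest i) {n : ℕ} {x : Vertex P B}
    (h : e.RBcast n i x) : x ∈ (e.state (n + 1) i).dag ∧ 1 ≤ x.round ∧ x.source = i :=
  have := (inv_state hq hi (n + 1)).sent x h.2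
  ⟨this.2.2.2, this.2.1, this.1⟩

/-- When the second round of the wave has been entered, all honest parties enter its first round
within time `Δ`. -/
theorem Synchronous.exists_enters_first (hS : e.Synchronous Δ T) {r a : ℕ} (hr : 1 ≤ r)
    (hi : e.Honest i) (ha : e.Enters a i (r + 1)) (haT : T ≤ e.time a) (hj : e.Honest j) :
    ∃ k, e.time k ≤ e.time a + Δ ∧ e.Enters k j r := by
  have he := hS.regular
  have hq := he.neverStarved
  obtain ⟨m, s, hm, hs, hsub⟩ := hS.exists_handled hi hj haT ⟨a, le_rfl, ha⟩
  have h1 := hs.le_round hq hj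
    ((ha.quorum he hi (Nat.lt_succ_self a)).trans (Finset.card_le_card (layer_mono hsub r)))
  have h2 := (inv_state hq hj (m + 1)).sent_exists
  have hl := ha.quorum he hi (Nat.lt_succ_self a)
  obtain ⟨x, hx⟩ := Finset.card_pos.1 (lt_of_lt_of_le (Nat.succ_pos _) hl)
  have hx := mem_layer.1 hx
  have hst := (inv_state hq hj (m + 1)).started_of_mem (hs.dag_subset (hsub hx.1)) (by omega)
  obtain ⟨k, hk, hkr⟩ := exists_enters hq hj hst hr (h1.trans hs.round_le)
  exact ⟨k, (e.time_mono (by omega)).trans hm, hkr⟩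

/-- When all honest parties have entered a round whose leader is honest and in which they wait for
the vertex of the leader, they leave it within time `Δ`. -/
theorem Synchronous.exists_enters_second (hS : e.Synchronous Δ T) (hw : 1 ≤ w)
    (hl : e.Honest (c.leader₁ w)) {t : ℝ}
    (hT : ∀ k p, e.Honest p → e.Enters k p (4 * w - 3) → T ≤ e.time k)
    (h : ∀ p, e.Honest p → ∃ k, e.time k ≤ t ∧ e.Enters k p (4 * w - 3)) (hj : e.Honest j) :
    ∃ k, e.time k ≤ t + Δ ∧ e.Enters k j (4 * w - 2) := by
  have he := hS.regular
  have hq := he.neverStarved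
  obtain ⟨N, hNt, hN⟩ := e.exists_last (t := t) (by
    obtain ⟨k, hk, -⟩ := h j hj
    exact ⟨k, hk⟩)
  have h' : ∀ p, e.Honest p → ∃ k < N + 1, e.Enters k p (4 * w - 3) := fun p hp => by
    obtain ⟨k, hk, hkr⟩ := h p hp
    exact ⟨k, Nat.lt_succ_of_le (hN k hk), hkr⟩
  obtain ⟨k, hk, hkr⟩ := h' j hj
  obtain ⟨m, s, hm, hs, hsub⟩ := hS.exists_handled hj hj
    ((hT k j hj hkr).trans (e.time_mono (Nat.le_of_lt_succ hk))) ⟨k, Nat.le_of_lt_succ hk, hkr⟩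
  have h1 := hs.le_round_of_enters he hj hsub hk hkr
  have hround : 4 * w - 2 ≤ (e.state (m + 1) j).round := by
    rcases h1.eq_or_lt with h1 | h1
    -- A party still in the first round now holds a quorum and the leader vertex, and advances
    -- within this very event.
    · have hfull := (card_layer_allDags hq h').trans (Finset.card_le_card (layer_mono hsub _))
      rw [hs.round_eq _ (h1 ▸ hfull)]
      · omega
      · refine .inr (.inl ⟨by omega, ?_⟩)
        obtain ⟨l, hlN, x, hx, hxr⟩ := h' _ hl
        refine ⟨x, mem_layer.2 ⟨hsub (hx.mem_allDags hq hl hlN), by omega⟩, ?_⟩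
        rw [(hx.mem_dag hq hl).2.2, show wave s.round = w by unfold wave; omega]
    · exact le_trans (by omega) hs.round_le
  have hst : (e.state (m + 1) j).started = true := by
    obtain ⟨x, hx, -⟩ := hkr
    exact (inv_state hq hj (m + 1)).started_of_mem
      (hs.dag_subset (hsub (hx.mem_allDags hq hj hk))) (hx.mem_dag hq hj).2.1
  obtain ⟨k, hk, hkr⟩ := exists_enters hq hj hst (by omega) hround
  exact ⟨k, (e.time_mono (Nat.le_of_lt_succ hk)).trans (hm.trans (by linarith)), hkr⟩

/-- When all honest parties have entered a round, they leave it when their timers expire. -/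
theorem Synchronous.exists_enters_succ (hS : e.Synchronous Δ T) (hτ : Δ < c.timeout) {r : ℕ}
    (hr : 1 ≤ r) {t : ℝ} (hT : ∀ k p, e.Honest p → e.Enters k p r → T ≤ e.time k)
    (h : ∀ p, e.Honest p → ∃ k, e.time k ≤ t ∧ e.Enters k p r) (hj : e.Honest j) :
    ∃ k, e.time k ≤ t + c.timeout ∧ e.Enters k j (r + 1) := by
  have he := hS.regular
  have hq := he.neverStarved
  obtain ⟨N, hNt, hN⟩ := e.exists_last (t := t) (by
    obtain ⟨k, hk, -⟩ := h j hj
    exact ⟨k, hk⟩)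
  have h' : ∀ p, e.Honest p → ∃ k < N + 1, e.Enters k p r := fun p hp => by
    obtain ⟨k, hk, hkr⟩ := h p hp
    exact ⟨k, Nat.lt_succ_of_le (hN k hk), hkr⟩
  obtain ⟨g, hg, hgr⟩ := h' j hj
  have hgt : e.time g ≤ t := (e.time_mono (Nat.le_of_lt_succ hg)).trans hNt
  obtain ⟨m, s, hm, hs, hsub⟩ := hS.exists_handled hj hj
    ((hT g j hj hgr).trans (e.time_mono (Nat.le_of_lt_succ hg))) ⟨g, Nat.le_of_lt_succ hg, hgr⟩
  obtain ⟨k, hk⟩ := exists_enters_round he (show 1 ≤ r + 1 by omega) j hj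
  refine ⟨k, ?_, hk⟩
  by_contra hlt
  push Not at hlt
  -- The quorum has arrived by `t + Δ`, before the supposed late entry at `k`; so the timer started
  -- at `g` bounds the time of `k`.
  have hmk : m < k := by
    by_contra hle
    have := e.time_mono (not_lt.1 hle)
    linarith
  have hgk : g < k := by
    by_contra hle
    have := e.time_mono (not_lt.1 hle)
    linarith [hS.nonneg]
  have hst := hgr.state hq hj hgk
  have hround : (e.state k j).round = r := by
    by_contra hne
    obtain ⟨k', hk', hkr⟩ := exists_enters hq hj (r := r + 1) hst.1 (by omega) (by omega)
    have := hkr.unique hq hj hk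
    omega
  have hfull : 2 * c.f + 1 ≤ (layer (e.state k j).dag r).card :=
    (card_layer_allDags hq h').trans (Finset.card_le_card (layer_mono
      ((hsub.trans hs.dag_subset).trans (dag_mono hq hj hmk)) r))
  have := time_le_of_quorum hq hj hround hfull hgr hgk
  linarith

/-- If the vertex `l` of an honest second leader reaches all honest parties before their timers of
its round expire, it receives the votes of all honest parties. -/
theorem mem_strongEdges_of_leader (he : e.Regular) (hw : 1 ≤ w) (hl : e.Honest (c.leader₂ w))
    {h : ℕ} {l : Vertex P B} (hlb : e.RBcast h (c.leader₂ w) l) (hlr : l.round = 4 * w - 1)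
    (hin : ∀ m n p, e.Honest p → e.Enters m p (4 * w - 1) → e.time m + c.timeout ≤ e.time n →
      l ∈ (e.state n p).dag) :
    ∀ n j x, e.Honest j → e.RBcast n j x → x.round = 4 * w → l ∈ x.strongEdges := by
  intro n
  induction n using Nat.strong_induction_on with
  | _ n ih =>
    intro j x hj hx hxr
    obtain ⟨d, hd⟩ := hx.origin he hj
    have hld : l ∈ d := by
      -- A jump follows an earlier honest vertex `y`, to which the induction hypothesis applies. An
      -- expired timer is covered by `hin`. In the last case the leader vertex seen is `l` by
      -- uniqueness.
      rcases hd.reason with h | ⟨y, hy, hyr, hys, m, hm, hyb⟩ | ⟨m, -, hm, ht⟩ | ⟨s, hs, hsr, hsw, hsm⟩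
      · omega
      · exact hd.closed y hy (strongEdges_subset_edges y (ih m hm _ y hys hyb (by omega)))
      · rw [hxr] at hm
        exact hd.le (hin m n j hj hm ht)
      · have : ∃ z ∈ layer s.dag s.round, z.source = c.leader₂ (wave s.round) := by
          rcases hsm with h | h | h | h | h
          · rw [hsw] at h; cases h
          · omega
          · omega
          · exact h.2
          · omega
        obtain ⟨z, hz, hzs⟩ := this
        obtain ⟨hz, hzr⟩ := mem_layer.1 hz
        rw [show wave s.round = w by unfold wave; omega] at hzs
        obtain ⟨hl1, hl2, hl3⟩ := hlb.mem_dag he.neverStarved hl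
        rw [hs] at hz
        rwa [← dag_unique he hl hj hl1 (hd.ge hz) hl2 (by omega) (by rw [hzs, hl3])]
    rw [hd.strongEdges]
    exact mem_layer.2 ⟨hld, by omega⟩

/-- Both leaders of a wave being honest, a leader vertex of the wave is committed. -/
theorem Synchronous.exists_commit (hS : e.Synchronous Δ T) (hτ : 3 * Δ < c.timeout) (hw : 1 ≤ w)
    (h₁ : e.Honest (c.leader₁ w)) (h₂ : e.Honest (c.leader₂ w)) (hT : e.EntersAfter (4 * w - 3) T) :
    ∃ l, ((l.round = 4 * w - 3 ∧ l.source = c.leader₁ w) ∨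
      (l.round = 4 * w - 1 ∧ l.source = c.leader₂ w)) ∧
      ∀ i, e.Honest i → ∃ m, l ∈ (e.state m i).committed := by
  have he := hS.regular
  have hq := he.neverStarved
  have hΔ := hS.nonneg
  have hT' : ∀ k p, e.Honest p → e.Enters k p (4 * w - 3) → T ≤ e.time k :=
    fun k p hp ⟨x, hx, hxr⟩ => hT k p x hp hx hxr
  obtain ⟨a, pa, hpa, ha, hamin⟩ := exists_first_enters he (show 1 ≤ 4 * w - 2 by omega)
  have haT : T ≤ e.time a := by
    obtain ⟨k, hk⟩ := exists_enters_round he (show 1 ≤ 4 * w - 3 by omega) pa hpa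
    exact (hT' k pa hpa hk).trans (e.time_mono (hk.le hq hpa ha (by omega) (by omega)))
  have hB1 : ∀ p, e.Honest p → ∃ k, e.time k ≤ e.time a + Δ ∧ e.Enters k p (4 * w - 3) :=
    fun p hp => hS.exists_enters_first (by omega) hpa
      (by rwa [show 4 * w - 3 + 1 = 4 * w - 2 by omega]) haT hp
  have hB2 : ∀ p, e.Honest p → ∃ k, e.time k ≤ e.time a + Δ + Δ ∧ e.Enters k p (4 * w - 2) :=
    fun p hp => hS.exists_enters_second hw h₁ hT' hB1 hp
  have hB3 : ∀ p, e.Honest p →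
      ∃ k, e.time k ≤ e.time a + Δ + Δ + c.timeout ∧ e.Enters k p (4 * w - 1) := fun p hp => by
    have := hS.exists_enters_succ (by linarith) (by omega)
      (fun k p hp hk => haT.trans (e.time_mono (hamin k p hp hk))) hB2 hp
    rwa [show 4 * w - 2 + 1 = 4 * w - 1 by omega] at this
  obtain ⟨b, pb, hpb, ⟨xb, hxb, hxbr⟩, hbmin⟩ :=
    exists_first_enters he (show 1 ≤ 4 * w - 1 by omega)
  obtain ⟨db, hdb⟩ := hxb.origin he hpb
  -- A jump would contradict the minimality of `b`. Votes commit the first leader, and the remaining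
  -- case is an expired timer.
  rcases hdb.reason with h | ⟨y, hy, hyr, hys, m, hm, hyb⟩ | ⟨m, -, hm, ht⟩ | ⟨s, hs, hsr, hsw, hsm⟩
  · omega
  · have := hbmin m _ hys ⟨y, hyb, by omega⟩
    omega
  swap
  · obtain ⟨l, hlr, hls, h⟩ := exists_commit_of_hasVotes he hpb hw hdb
      (hxb.mem_dag hq hpb).1 hxbr hs hsr hsw hsm
    exact ⟨l, .inl ⟨hlr, hls⟩, h⟩
  have hab : e.time a + c.timeout ≤ e.time b := by
    have := e.time_mono (hamin m pb hpb (by rwa [show 4 * w - 2 = xb.round - 1 by omega]))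
    linarith
  obtain ⟨h, hht, l, hlb, hlr⟩ := hB3 _ h₂
  -- The vertex `l` is broadcast by `a + 2Δ + τ ≤ b + 2Δ` and handled by `b + 3Δ < b + τ`, while no
  -- honest timer of this round starts before `b`. This is where `3Δ < τ` is used.
  have hin : ∀ m n p, e.Honest p → e.Enters m p (4 * w - 1) → e.time m + c.timeout ≤ e.time n →
      l ∈ (e.state n p).dag := by
    intro m n p hp hm hmn
    have hbm := e.time_mono (hbmin m p hp hm)
    have hbh := e.time_mono (hbmin h _ h₂ ⟨l, hlb, hlr⟩)
    obtain ⟨m', s, hm', hs, hsub⟩ := hS.exists_handled h₂ hp (by linarith)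
      ⟨h, le_rfl, l, hlb, hlr⟩
    refine dag_mono hq hp ?_ (hs.dag_subset (hsub (hlb.mem_allDags hq h₂ (Nat.lt_succ_self h))))
    by_contra hle
    have := e.time_mono (show n ≤ m' by omega)
    linarith
  have hvotes := mem_strongEdges_of_leader he hw h₂ hlb hlr hin
  have hls := (hlb.mem_dag hq h₂).2.2
  refine ⟨l, .inr ⟨hlr, hls⟩, fun i hi => ?_⟩
  obtain ⟨n, x, hx, hxr⟩ := exists_enters_round he (show 1 ≤ 4 * w + 1 by omega) i hi
  obtain ⟨d, hd⟩ := hx.origin he hi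
  refine exists_commit_of_votes he hi (hx.mem_dag hq hi).1 (w := w) (n := n + 1)
    ⟨hw, .inr ⟨hxr, hlr, hls⟩⟩ ?_ hi
  -- The honest vertices among the strong edges of `x` number at least `f + 1`, and each has a
  -- strong edge to `l`.
  refine (card_honest_layer he hi hd.ge (by omega) hd.quorum).trans (Finset.card_le_card ?_)
  intro y hy
  obtain ⟨hy, hys⟩ := Finset.mem_filter.1 hy
  rw [hd.strongEdges]
  refine Finset.mem_filter.2 ⟨hy, ?_⟩
  obtain ⟨hy, hyr⟩ := mem_layer.1 hy
  have hy' := hd.ge hy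
  obtain ⟨k, -, hk⟩ := exists_rbcast_of_mem_sent hys
    (mem_sent_of_honest he hi hy' (by omega) hys)
  have hly := hvotes k _ y hys hk (by omega)
  exact .single ⟨(inv_state hq hi (n + 1)).closed y hy' (strongEdges_subset_edges y hly),
    by omega, hly⟩

end wave

/-! ### Validity -/

/-- Only finitely many events precede `GST`, each with finitely many deliveries to wait for, so one
event index `K` is late enough for all. -/
theorem exists_caughtUp (he : e.Regular) (GST : ℝ) : ∃ T, e.CaughtUp GST T := by
  obtain ⟨M, hM⟩ := (Filter.tendsto_atTop.1 e.time_unbounded GST).exists_forall_of_atTop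
  have hlt : ∀ n, e.time n < GST → n ∈ Finset.range M := by
    intro n hn
    by_contra hle
    exact absurd (hM n (by simpa using hle)) (not_le.2 hn)
  -- Finiteness is needed only in `n` and `j`: the event fixes `i`, `x`, `r` and `p`.
  have hd : ∀ᶠ K in Filter.atTop, ∀ n ∈ Finset.range M, ∀ j ∈ (Finset.univ : Finset P),
      ∀ i x r p, e.Honest i → e.Honest j → e.event n = .deliver i x r p →
        ∃ m ≤ K, e.event m = .deliver j x r p := by
    refine (Filter.eventually_all_finset _).2 fun n _ => (Filter.eventually_all_finset _).2
      fun j _ => ?_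
    by_cases h : ∃ i x r p, e.Honest i ∧ e.Honest j ∧ e.event n = .deliver i x r p
    · obtain ⟨i, x, r, p, hi, hj, hev⟩ := h
      obtain ⟨m, hm⟩ := he.broadcast.agreement n i j x r p hi hj hev
      filter_upwards [Filter.eventually_ge_atTop m] with K hK i' x' r' p' _ _ hev'
      rw [hev] at hev'
      injection hev' with _ h2 h3 h4
      exact ⟨m, hK, h2 ▸ h3 ▸ h4 ▸ hm⟩
    · exact .of_forall fun K i x r p hi hj hev => absurd ⟨i, x, r, p, hi, hj, hev⟩ h
  have hb : ∀ᶠ K in Filter.atTop, ∀ n ∈ Finset.range M, ∀ j ∈ (Finset.univ : Finset P),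
      ∀ i ∈ (Finset.univ : Finset P), ∀ x ∈ (e.state (n + 1) i).sent, e.Honest i → e.Honest j →
        e.RBcast n i x → ∃ m ≤ K, e.event m = .deliver j x x.round i := by
    refine (Filter.eventually_all_finset _).2 fun n _ => (Filter.eventually_all_finset _).2
      fun j _ => (Filter.eventually_all_finset _).2 fun i _ =>
        (Filter.eventually_all_finset _).2 fun x _ => ?_
    by_cases h : e.Honest i ∧ e.Honest j ∧ e.RBcast n i x
    · obtain ⟨m, hm⟩ := he.broadcast.validity n i j x h.1 h.2.1 h.2.2
      filter_upwards [Filter.eventually_ge_atTop m] with K hK _ _ _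
      exact ⟨m, hK, hm⟩
    · exact .of_forall fun K hi hj hx => absurd ⟨hi, hj, hx⟩ h
  obtain ⟨K, hK⟩ := (hd.and hb).exists
  refine ⟨e.time K, fun n i j x r p hi hj hn hev => ?_,
    fun n i j x hi hj hn hx => ?_⟩
  · obtain ⟨m, hm, h⟩ := hK.1 n (hlt n hn) j (Finset.mem_univ _) i x r p hi hj hev
    exact ⟨m, h, e.time_mono hm⟩
  · obtain ⟨m, hm, h⟩ := hK.2 n (hlt n hn) j (Finset.mem_univ _) i (Finset.mem_univ _) x hx.2
      hi hj hx
    exact ⟨m, h, e.time_mono hm⟩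

theorem Synchronous.validity {Δ T : ℝ} (hS : e.Synchronous Δ T) (hτ : 3 * Δ < c.timeout)
    (hleaders : ∀ w₀, ∃ w ≥ w₀, e.Honest (c.leader₁ w) ∧ e.Honest (c.leader₂ w)) :
    e.Validity := by
  have he := hS.regular
  have hq := he.neverStarved
  intro n k b q hk hev i hi
  have hq1 : 1 ≤ q := by
    have hstep := e.state_step n k hk (by rw [hev]; rfl)
    rw [hev] at hstep
    have := hstep.1
    omega
  obtain ⟨nx, x, hx, hxr⟩ := exists_enters_round he hq1 k hk
  have hblock := block_eq_of_aBcast hq hk hev hx hxr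
  obtain ⟨hxd, hx1, hxs⟩ := hx.mem_dag hq hk
  -- The disjunct for corrupted parties is there because monotonicity is demanded of all parties,
  -- and corrupted DAGs may shrink.
  obtain ⟨N, hN⟩ := exists_forall_honest (e := e) (Q := fun p n => x ∈ (e.state n p).dag ∨
      ¬ e.Honest p) (fun p m n hmn h => by
        by_cases hp : e.Honest p
        · exact .inl (dag_mono hq hp hmn (h.resolve_right (not_not.2 hp)))
        · exact .inr hp)
    (fun p hp => by
      obtain ⟨m, hm⟩ := exists_allDags_subset he hp (n := nx + 1)
        ⟨k, hk, (inv_state hq hk _).started_of_mem hxd hx1⟩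
      exact ⟨m, .inl (hm (dag_subset_allDags hk _ hxd))⟩)
  obtain ⟨M, hM⟩ := (Filter.tendsto_atTop.1 e.time_unbounded T).exists_forall_of_atTop
  set L := max N M
  -- Honest vertices of rounds above `R` are created after event `L`, hence after time `T` and with
  -- `x` in the DAG of their creator.
  set R := Finset.univ.sup fun p => (e.state L p).round
  have hlate : ∀ m p y, e.Honest p → e.RBcast m p y → R < y.round → L ≤ m := by
    intro m p y hp hy hR
    by_contra hlt
    have h1 := ((inv_state hq hp L).sent y (sent_mono hq hp (not_le.1 hlt) hy.2)).2.2.1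
    have h2 : (e.state L p).round ≤ R :=
      Finset.le_sup (f := fun p => (e.state L p).round) (Finset.mem_univ p)
    dsimp only at h1
    omega
  obtain ⟨w, hw, h₁, h₂⟩ := hleaders (R + q + 1)
  have hT : e.EntersAfter (4 * w - 3) T := by
    intro m p y hp hy hyr
    exact hM m ((le_max_right N M).trans (hlate m p y hp hy (by omega)))
  obtain ⟨l, hl, hcom⟩ := hS.exists_commit hτ (by omega) h₁ h₂ hT
  obtain ⟨m, hm⟩ := hcom i hi
  have hdel := delivered_state hq hi m
  have hlm := hdel.committed_mem l hm
  have hls : e.Honest l.source := by rcases hl with hl | hl <;> rw [hl.2] <;> assumption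
  have hlr : R + q < l.round := by omega
  obtain ⟨m', -, hlb⟩ := exists_rbcast_of_mem_sent hls
    (mem_sent_of_honest he hi hlm (by omega) hls)
  obtain ⟨d, hd⟩ := hlb.origin he hls
  have hxd : x ∈ d := hd.le (dag_mono hq hls
    ((le_max_left N M).trans (hlate m' _ l hls hlb (by omega)))
    ((hN _ hls).resolve_right (not_not.2 hls)))
  -- The path exists in the DAG of the leader at creation; closedness transfers it to the DAG of
  -- `i`.
  have hpath : Path d l x := by
    rw [hd.vertex]
    exact path_createVertex _ _ _ _ hxd hx1 (by omega)
  obtain ⟨hxm, hpath⟩ := hpath.restrict (inv_state hq hi m).closed hlm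
  have := hdel.output_of_delivered x (hdel.delivered_of_path l hm x hxm hx1 hpath)
  rw [hblock, hxr, hxs] at this
  exact ⟨m, this⟩

end Execution

end

end Bullshark

/-! ### The main theorem -/

theorem mainTheorem6 {P : Type*} {B : Type*} [Fintype P] (c : Bullshark.Setup P B)
    (Δ GST : ℝ) (hΔ : 0 < Δ) (htimeout : 3 * Δ < c.timeout)
    (e : Bullshark.Execution c) (hqueue : e.NeverStarved)
    (hrb : e.ReliableBroadcast) (htimely : e.TimelyBroadcast Δ GST)
    (hleaders : ∀ w₀, ∃ w ≥ w₀, e.Honest (c.leader₁ w) ∧ e.Honest (c.leader₂ w)) :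
    e.Validity ∧
    ∀ T w, GST ≤ T → e.CaughtUp GST T → 1 ≤ w →
      e.Honest (c.leader₁ w) → e.Honest (c.leader₂ w) → e.EntersAfter (4 * w - 3) T →
      ∀ i, e.Honest i → e.CommitsInWave i w := by
  have he : e.Regular := ⟨hqueue, hrb⟩
  refine ⟨?_, fun T w _ hT hw h₁ h₂ hent i hi => ?_⟩
  · obtain ⟨T, hT⟩ := Bullshark.Execution.exists_caughtUp he GST
    exact (Bullshark.Execution.synchronous_of_caughtUp hΔ.le he htimely hT).validity htimeout
      hleaders
  · obtain ⟨l, hl, h⟩ := (Bullshark.Execution.synchronous_of_caughtUp hΔ.le he htimely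
      hT).exists_commit htimeout hw h₁ h₂ hent
    obtain ⟨m, hm⟩ := h i hi
    exact ⟨m, l, hm, hl⟩
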